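/- **Setting.** Consider two parties, Alice with a finite set $\mathcal A$ and Bob with a finite set $\mathcal B$ of $\{0,1\}$-valued observables. An experimental result is a vector $q=(q_A,q_B,q_{AB})_{A\in\mathcal A,\,B\in\mathcal B}$ of real numbers, where $q_A$, $q_B$, $q_{AB}$ stand for $\Pr[A=1]$, $\Pr[B=1]$, $\Pr[A=1\wedge B=1]$. The *correlation polytope* is the convex hull of the results of the classical configurations (assignments of outcomes $0,1$ to all observables, with $q_{AB}=q_Aq_B$). A *Bell inequality* is a linear inequality $F(q)\le b_0$ that holds on the correlation polytope; it is *tight* if its face $\{q\in\text{polytope}: F(q)=b_0\}$ is a facet, i.e. nonempty and of dimension one less than the polytope. Let $s,t\ge 0$, let $b_{A_1},\dots,b_{A_s},b_{B_1},\dots,b_{B_t}$ be integers, put $b_X=1-\sum_i b_{A_i}-\sum_j b_{B_j}$ and $n=s+t+1$. The *hypermetric inequality* of $b$ is $\sum_{uv}b_ub_vx_{uv}\le 0$, summed over the edges $uv$ of the complete graph on $X,A_1,\dots,A_s,B_1,\dots,B_t$. The *triangular elimination* of an inequality $\sum_{uv}a_{uv}x_{uv}\le a_0$ on this graph is the inequality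 $$\sum_i a_{XA_i}x_{XA_i}+\sum_j a_{XB_j}x_{XB_j}+\sum_{i,j}a_{A_iB_j}x_{A_iB_j}+\sum_{i<i'}\bigl(a_{A_iA_{i'}}x_{A_iB'_{ii'}}-|a_{A_iA_{i'}}|x_{A_{i'}B'_{ii'}}\bigr)+\sum_{j<j'}\bigl(a_{B_jB_{j'}}x_{A'_{jj'}B_j}-|a_{B_jB_{j'}}|x_{A'_{jj'}B_{j'}}\bigr)\le a_0,$$ for Alice's observables $A_i$ and $A'_{jj'}$ ($1\le j<j'\le t$) and Bob's observables $B_j$ and $B'_{ii'}$ ($1\le i<i'\le s$). It becomes an inequality in $q$ by $x_{XA}=q_A$, $x_{XB}=q_B$, $x_{AB}=q_A+q_B-2q_{AB}$. **Theorem.** For $a_{uv}=b_ub_v$, the left-hand side of the triangular elimination, written in $q$, is $2H_b(q)$, where $$\begin{aligned}H_b(q)={}&\sum_{i}b_{A_i}\Bigl(\tfrac{1-b_{A_i}}2-\sum_{i'<i,\ i'\sim i}b_{A_{i'}}\Bigr)q_{A_i}+\sum_{j}b_{B_j}\Bigl(\tfrac{1-b_{B_j}}2-\sum_{j'<j,\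 j'\sim j}b_{B_{j'}}\Bigr)q_{B_j}\\&+\sum_{j<j',\ b_{B_j}b_{B_{j'}}<0}b_{B_j}b_{B_{j'}}q_{A'_{jj'}}+\sum_{i<i',\ b_{A_i}b_{A_{i'}}<0}b_{A_i}b_{A_{i'}}q_{B'_{ii'}}-\sum_{i,j}b_{A_i}b_{B_j}q_{A_iB_j}\\&-\sum_{i<i'}b_{A_i}b_{A_{i'}}q_{A_iB'_{ii'}}+\sum_{i<i'}|b_{A_i}b_{A_{i'}}|q_{A_{i'}B'_{ii'}}-\sum_{j<j'}b_{B_j}b_{B_{j'}}q_{A'_{jj'}B_j}+\sum_{j<j'}|b_{B_j}b_{B_{j'}}|q_{A'_{jj'}B_{j'}},\end{aligned}$$ and $i'\sim i$ (resp. $j'\sim j$) means that the two weights $b_{A_{i'}},b_{A_i}$ (resp. $b_{B_{j'}},b_{B_j}$) are both positive or both $\le 0$. The inequality $H_b(q)\le 0$ is a tight Bell inequality if one of the following conditions is satisfied. 1. For some integer $l>1$, the integers $b_{A_1},\dots,b_{A_s},b_{B_1},\dots,b_{B_t}$ and $b_X$ contain $l+1$ entries equal to $1$ and $l$ entries equal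 to $-1$, and the other entries (if any) are equal to $0$. 2. At least $3$ and at most $n-3$ of the integers $b_{A_1},\dots,b_{A_s},b_{B_1},\dots,b_{B_t}$ and $b_X$ are positive, and all the others are equal to $-1$. -/

import Mathlib

open scoped BigOperators

/-- Coordinates of a bipartite experiment with observables `α` (Alice) and `β` (Bob):
one for each observable of Alice, each observable of Bob and each joint measurement.
They are also the edges `XA`, `XB`, `AB` of the complete tripartite graph with parts
`{X}`, `α`, `β`. -/
abbrev BellCoord (α β : Type) : Type := α ⊕ β ⊕ α × β

/-- The space of experimental results. -/
abbrev BellVec (α β : Type) : Type := BellCoord α β → ℝ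

namespace BellVec

variable {α β : Type}

/-- The coordinate of an observable `a` of Alice, `q_a = Pr[a = 1]` (or `x_{Xa}`). -/
def atA (q : BellVec α β) (a : α) : ℝ := q (Sum.inl a)

/-- The coordinate of an observable `b` of Bob, `q_b = Pr[b = 1]` (or `x_{Xb}`). -/
def atB (q : BellVec α β) (b : β) : ℝ := q (Sum.inr (Sum.inl b))

/-- The joint coordinate `q_{ab} = Pr[a = 1 ∧ b = 1]` (or `x_{ab}`). -/
def atAB (q : BellVec α β) (a : α) (b : β) : ℝ := q (Sum.inr (Sum.inr (a, b)))

end BellVec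

/-- The experimental result of the classical configuration in which the observables with
outcome `1` are those of `f` and `g`. -/
def classicalResult {α β : Type} (f : α → Bool) (g : β → Bool) : BellVec α β
  | Sum.inl a => if f a then 1 else 0
  | Sum.inr (Sum.inl b) => if g b then 1 else 0
  | Sum.inr (Sum.inr (a, b)) => if f a && g b then 1 else 0

/-- The correlation polytope: all experimental results with a local hidden variable model,
that is, all convex combinations of results of classical configurations. -/
def correlationPolytope (α β : Type) : Set (BellVec α β) :=
  convexHull ℝ (Set.range fun c : (α → Bool) × (β → Bool) => classicalResult c.1 c.2)

/-- `F q ≤ b₀` is a Bell inequality: a linear inequality that is valid for every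
experimental result with a local hidden variable model. -/
structure IsBellInequality {α β : Type} (F : BellVec α β → ℝ) (b₀ : ℝ) : Prop where
  linear : IsLinearMap ℝ F
  valid : ∀ q ∈ correlationPolytope α β, F q ≤ b₀

/-- The face of the correlation polytope on which `F q = b₀`. -/
def bellFace {α β : Type} (F : BellVec α β → ℝ) (b₀ : ℝ) : Set (BellVec α β) :=
  {q ∈ correlationPolytope α β | F q = b₀}

/-- `F q ≤ b₀` is a tight Bell inequality: it is a Bell inequality, and its face is a facet of
the correlation polytope, that is, a nonempty face whose (affine) dimension is one less than
that of the polytope. -/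
structure IsTightBellInequality {α β : Type} (F : BellVec α β → ℝ) (b₀ : ℝ) : Prop where
  bell : IsBellInequality F b₀
  nonempty : (bellFace F b₀).Nonempty
  dim : Module.finrank ℝ (vectorSpan ℝ (bellFace F b₀)) + 1 =
    Module.finrank ℝ (vectorSpan ℝ (correlationPolytope α β))

/-- The affine isomorphism from correlation coordinates to cut coordinates,
`x_{Xa} = q_a`, `x_{Xb} = q_b`, `x_{ab} = q_a + q_b - 2 q_{ab}`. -/
def toCutCoord {α β : Type} (q : BellVec α β) : BellVec α β
  | Sum.inl a => q.atA a
  | Sum.inr (Sum.inl b) => q.atB b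
  | Sum.inr (Sum.inr (a, b)) => q.atA a + q.atB b - 2 * q.atAB a b

/-- The pairs `i < i'` of indices below `n`. -/
abbrev IndexPair (n : ℕ) : Type := {p : Fin n × Fin n // p.1 < p.2}

/-- Alice's observables after triangular elimination: the old `A_i`, `i < s`, and a new
`A'_{jj'}` for each pair `j < j'` of old observables of Bob. -/
abbrev ElimA (s t : ℕ) : Type := Fin s ⊕ IndexPair t

/-- Bob's observables after triangular elimination: the old `B_j`, `j < t`, and a new
`B'_{ii'}` for each pair `i < i'` of old observables of Alice. -/
abbrev ElimB (s t : ℕ) : Type := Fin t ⊕ IndexPair s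

/-- The nodes `X`, `A_i`, `B_j` of the complete graph on `1 + s + t` nodes. -/
abbrev CompleteNode (s t : ℕ) : Type := Option (Fin s ⊕ Fin t)

namespace CompleteNode

/-- The node `X`. -/
abbrev X {s t : ℕ} : CompleteNode s t := none

/-- The node `A_i`. -/
abbrev A {s t : ℕ} (i : Fin s) : CompleteNode s t := some (Sum.inl i)

/-- The node `B_j`. -/
abbrev B {s t : ℕ} (j : Fin t) : CompleteNode s t := some (Sum.inr j)

end CompleteNode

open CompleteNode in
/-- The left hand side, in cut coordinates `x`, of the triangular elimination of the
inequality `∑ a_{uv} x_{uv} ≤ a₀` (sum over the edges `uv` of the complete graph on the nodes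
`X`, `A_i`, `B_j`). -/
noncomputable def triangularElimination {s t : ℕ} (a : CompleteNode s t → CompleteNode s t → ℝ)
    (x : BellVec (ElimA s t) (ElimB s t)) : ℝ :=
  (∑ i : Fin s, a X (A i) * x.atA (Sum.inl i))
  + (∑ j : Fin t, a X (B j) * x.atB (Sum.inl j))
  + (∑ i : Fin s, ∑ j : Fin t, a (A i) (B j) * x.atAB (Sum.inl i) (Sum.inl j))
  + (∑ p : IndexPair s,
      (a (A p.1.1) (A p.1.2) * x.atAB (Sum.inl p.1.1) (Sum.inr p)
        - |a (A p.1.1) (A p.1.2)| * x.atAB (Sum.inl p.1.2) (Sum.inr p)))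
  + (∑ p : IndexPair t,
      (a (B p.1.1) (B p.1.2) * x.atAB (Sum.inr p) (Sum.inl p.1.1)
        - |a (B p.1.1) (B p.1.2)| * x.atAB (Sum.inr p) (Sum.inl p.1.2)))

/-- The weight vector `b = (b_X, b_{A_1}, …, b_{A_s}, b_{B_1}, …, b_{B_t})`, where
`b_X = 1 - ∑ b_{A_i} - ∑ b_{B_j}`. -/
def hypermetricWeight {s t : ℕ} (bA : Fin s → ℤ) (bB : Fin t → ℤ) : CompleteNode s t → ℤ
  | none => 1 - ∑ i, bA i - ∑ j, bB j
  | some (Sum.inl i) => bA i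
  | some (Sum.inr j) => bB j

/-- The coefficients `a_{uv} = b_u b_v` of the hypermetric inequality `∑ b_u b_v x_{uv} ≤ 0`. -/
def hypermetricCoeff {s t : ℕ} (bA : Fin s → ℤ) (bB : Fin t → ℤ) (u v : CompleteNode s t) : ℝ :=
  (hypermetricWeight bA bB u : ℝ) * (hypermetricWeight bA bB v : ℝ)

/-- The left hand side of the Bell inequality of the weight vector `b`, in correlation
coordinates. The ranges of the sums are given by the signs of the weights, so that the formula
makes sense for every order of the weights; if within each party the positive weights come
first, then `0 < bA i` means `i ≤ s₊`, and a pair `i < i'` of indices of opposite signs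
is one with `i ≤ s₊ < i'`. -/
noncomputable def hypermetricBell {s t : ℕ} (bA : Fin s → ℤ) (bB : Fin t → ℤ)
    (q : BellVec (ElimA s t) (ElimB s t)) : ℝ :=
  (∑ i : Fin s with 0 < bA i,
      (bA i : ℝ) * ((1 - (bA i : ℝ)) / 2 - ∑ i' : Fin s with i' < i ∧ 0 < bA i', (bA i' : ℝ))
        * q.atA (Sum.inl i))
  + (∑ i : Fin s with bA i ≤ 0,
      (bA i : ℝ) * ((1 - (bA i : ℝ)) / 2 - ∑ i' : Fin s with i' < i ∧ bA i' ≤ 0, (bA i' : ℝ))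
        * q.atA (Sum.inl i))
  + (∑ j : Fin t with 0 < bB j,
      (bB j : ℝ) * ((1 - (bB j : ℝ)) / 2 - ∑ j' : Fin t with j' < j ∧ 0 < bB j', (bB j' : ℝ))
        * q.atB (Sum.inl j))
  + (∑ j : Fin t with bB j ≤ 0,
      (bB j : ℝ) * ((1 - (bB j : ℝ)) / 2 - ∑ j' : Fin t with j' < j ∧ bB j' ≤ 0, (bB j' : ℝ))
        * q.atB (Sum.inl j))
  + (∑ p : IndexPair t with bB p.1.1 * bB p.1.2 < 0,
      (bB p.1.1 : ℝ) * (bB p.1.2 : ℝ) * q.atA (Sum.inr p))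
  + (∑ p : IndexPair s with bA p.1.1 * bA p.1.2 < 0,
      (bA p.1.1 : ℝ) * (bA p.1.2 : ℝ) * q.atB (Sum.inr p))
  - (∑ i : Fin s, ∑ j : Fin t,
      (bA i : ℝ) * (bB j : ℝ) * q.atAB (Sum.inl i) (Sum.inl j))
  - (∑ p : IndexPair s,
      (bA p.1.1 : ℝ) * (bA p.1.2 : ℝ) * q.atAB (Sum.inl p.1.1) (Sum.inr p))
  + (∑ p : IndexPair s,
      |(bA p.1.1 : ℝ) * (bA p.1.2 : ℝ)| * q.atAB (Sum.inl p.1.2) (Sum.inr p))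
  - (∑ p : IndexPair t,
      (bB p.1.1 : ℝ) * (bB p.1.2 : ℝ) * q.atAB (Sum.inr p) (Sum.inl p.1.1))
  + (∑ p : IndexPair t,
      |(bB p.1.1 : ℝ) * (bB p.1.2 : ℝ)| * q.atAB (Sum.inr p) (Sum.inl p.1.2))

/-- For some `l > 1`, the weights (including `b_X`) contain `l + 1` entries equal to `1` and
`l` entries equal to `-1`, and all the other entries are `0`. -/
def IsPureHypermetricWeight {s t : ℕ} (b : CompleteNode s t → ℤ) : Prop :=
  ∃ l : ℕ, 1 < l ∧
    (Finset.univ.filter fun v => b v = 1).card = l + 1 ∧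
    (Finset.univ.filter fun v => b v = -1).card = l ∧
    ∀ v, b v = 1 ∨ b v = -1 ∨ b v = 0

/-- At least `3` and at most `n - 3` of the `n = s + t + 1` weights (including `b_X`) are
positive, and all the other weights are `-1`. -/
def IsMinusOneHypermetricWeight {s t : ℕ} (b : CompleteNode s t → ℤ) : Prop :=
  3 ≤ (Finset.univ.filter fun v => 0 < b v).card ∧
    (Finset.univ.filter fun v => 0 < b v).card + 3 ≤ s + t + 1 ∧
    ∀ v, 0 < b v ∨ b v = -1

/-! In cut coordinates the classical results are the cut vectors of a tripartite graph. A cut is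
given by a set `S` of old nodes and a set `T` of new ones. On such a cut the triangular elimination
equals `σ (1 - σ)`, where `σ` is the integer weight of `S`, plus one defect per new node
(`triangularElimination_hypermetricCoeff_elimCutVec`). The first term is nonpositive because `σ` is
an integer, and each defect is nonpositive by a triangle inequality, so the inequality is valid for
all weights. Equality holds when `σ` is `0` or `1` (a root) and each new node either lies on the
side of the second node of its pair or is free to lie on either side (`IsSlack`).

Tightness is proved dually: a linear form vanishing on all classical results where `H_b` vanishes is
a multiple of `H_b`. Then the face spans the kernel of `H_b`. A form vanishing on the whole polytope
would be a multiple of `H_b`, hence zero because `H_b` is negative somewhere, so the polytope spans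
the whole space.

Both conditions on the weights enter only through `IsFacetWeight`. Roots are built from a few
positive nodes, balanced by nodes of weight `-1`. Total weight `1` and three positive nodes
guarantee enough of the latter (`IsFacetWeight.add_add_le`).

The form is read as a weighting of the edges. In `IsFacetWeight.exists_eq_mul_of_elimination`,
flipping one free new node gives linear equations that determine its row up to a scalar
(`IsFacetWeight.sum_row`), and flipping two shows that edges between new nodes have weight zero. If
every new node follows the second node of its pair, the weighting collapses to one on the complete
graph that vanishes on all roots. By the facet property of the hypermetric inequality itself
(`IsFacetWeight.exists_eq_mul_of_cutWeight`) it is a multiple of `b u * b v`, which fixes the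
remaining coefficients. -/

/-- The total weight of the edges cut by `S`. -/
def cutWeight {U : Type*} [Fintype U] [DecidableEq U] (g : U → U → ℝ) (S : Finset U) : ℝ :=
  ∑ u ∈ S, ∑ v ∈ Sᶜ, g u v

theorem cutWeight_eq_sub {U : Type*} [Fintype U] [DecidableEq U] (g : U → U → ℝ) (S : Finset U) :
    cutWeight g S = ∑ u ∈ S, ∑ v, g u v - ∑ u ∈ S, ∑ v ∈ S, g u v := by
  unfold cutWeight
  rw [← Finset.sum_sub_distrib]
  refine Finset.sum_congr rfl fun u _ => ?_
  rw [← Finset.sum_add_sum_compl S (g u)]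
  ring

/-- Two cuts of known weight that differ in a single node thus yield a linear equation on the row of
that node. All uniqueness arguments below rest on this. -/
theorem cutWeight_insert {U : Type*} [Fintype U] [DecidableEq U] {g : U → U → ℝ}
    (hsymm : ∀ u v, g u v = g v u) (hdiag : ∀ u, g u u = 0) {S : Finset U} {w : U} (hw : w ∉ S) :
    cutWeight g (insert w S) = cutWeight g S + ∑ v, g w v - 2 * ∑ v ∈ S, g w v := by
  have h : ∑ u ∈ S, g u w = ∑ u ∈ S, g w u := Finset.sum_congr rfl fun u _ => hsymm u w
  simp only [cutWeight_eq_sub, Finset.sum_insert hw, Finset.sum_add_distrib, hdiag, h]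
  ring

/-! ### Weights, roots, and the supply of nodes of weight `-1` -/

/-- The nodes of weight `-1`. -/
def negOnes {V : Type*} [Fintype V] (b : V → ℤ) : Finset V := Finset.univ.filter fun v => b v = -1

theorem mem_negOnes {V : Type*} [Fintype V] {b : V → ℤ} {v : V} : v ∈ negOnes b ↔ b v = -1 := by
  simp [negOnes]

/-- Weights of total `1` that are at least `-1`, at least three of them positive. -/
structure IsFacetWeight {V : Type*} [Fintype V] (b : V → ℤ) : Prop where
  sum_eq : ∑ v, b v = 1
  neg_one_le : ∀ v, -1 ≤ b v
  three_le : 3 ≤ (Finset.univ.filter fun v => 0 < b v).card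

/-- The cut of `S` satisfies the hypermetric inequality of `b` with equality. -/
def IsHypermetricRoot {V : Type*} (b : V → ℤ) (S : Finset V) : Prop :=
  ∑ v ∈ S, b v = 0 ∨ ∑ v ∈ S, b v = 1

theorem isHypermetricRoot_empty {V : Type*} (b : V → ℤ) : IsHypermetricRoot b ∅ := by
  simp [IsHypermetricRoot]

/-- The cut of `S` leaves a node attached to `i` and `i'` by triangular elimination free: `i`
and `i'` are on the same side if `b i * b i' > 0`, on opposite sides if `b i * b i' < 0`. -/
def IsSlack {V : Type*} (b : V → ℤ) (i i' : V) (S : Finset V) : Prop :=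
  (0 < b i * b i' → (i ∈ S ↔ i' ∈ S)) ∧ (b i * b i' < 0 → ¬(i ∈ S ↔ i' ∈ S))

theorem IsSlack.swap {V : Type*} {b : V → ℤ} {i i' : V} {S : Finset V} (h : IsSlack b i i' S) :
    IsSlack b i' i S := by
  unfold IsSlack at *
  rw [mul_comm (b i')]
  tauto

namespace IsFacetWeight

variable {V : Type*} [Fintype V] [DecidableEq V] {b : V → ℤ}

theorem trichotomy {V : Type*} [Fintype V] {b : V → ℤ} (hb : IsFacetWeight b)
    (v : V) : b v = -1 ∨ b v = 0 ∨ 0 < b v := by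
  have := hb.neg_one_le v
  omega

theorem exists_pos_ne (hb : IsFacetWeight b) (j k : V) : ∃ l, 0 < b l ∧ l ≠ j ∧ l ≠ k := by
  have h : 0 < ((Finset.univ.filter fun v => 0 < b v) \ {j, k}).card := by
    have h1 := Finset.le_card_sdiff {j, k} (Finset.univ.filter fun v => 0 < b v)
    have h2 := Finset.card_le_two (a := j) (b := k)
    have := hb.three_le
    omega
  obtain ⟨l, hl⟩ := Finset.card_pos.1 h
  simp only [Finset.mem_sdiff, Finset.mem_filter, Finset.mem_univ, true_and, Finset.mem_insert,
    Finset.mem_singleton, not_or] at hl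
  exact ⟨l, hl.1, hl.2⟩

/-- The total weight is `1`, and the other nodes can lower it only by `1` for each node of weight
`-1`. This guarantees that the sets of nodes of weight `-1` needed to balance positive nodes exist.
-/
theorem add_add_le (hb : IsFacetWeight b) {j k l : V} (hj : 0 < b j) (hk : 0 < b k) (hl : 0 < b l)
    (hjk : j ≠ k) (hjl : j ≠ l) (hkl : k ≠ l) : b j + b k + b l ≤ (negOnes b).card + 1 := by
  have h : ∑ v, ((if v = j then b j else 0) + (if v = k then b k else 0)
      + (if v = l then b l else 0) - (if b v = -1 then 1 else 0)) ≤ ∑ v, b v := by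
    refine Finset.sum_le_sum fun v _ => ?_
    have := hb.neg_one_le v
    by_cases h1 : v = j
    · subst h1; simp [hjk, hjl]; split_ifs <;> omega
    by_cases h2 : v = k
    · subst h2; simp [h1, hkl]; split_ifs <;> omega
    by_cases h3 : v = l
    · subst h3; simp [h1, h2]; split_ifs <;> omega
    simp [h1, h2, h3]; split_ifs <;> omega
  rw [hb.sum_eq] at h
  simp only [Finset.sum_sub_distrib, Finset.sum_add_distrib, Finset.sum_ite_eq', Finset.mem_univ,
    if_true, Finset.sum_boole] at h
  have : ((Finset.univ.filter fun v => b v = -1).card : ℤ) = (negOnes b).card := rfl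
  simp only [this] at h
  omega

theorem add_le (hb : IsFacetWeight b) {j k : V} (hj : 0 < b j) (hk : 0 < b k) (hjk : j ≠ k) :
    b j + b k ≤ (negOnes b).card := by
  obtain ⟨l, hl, h1, h2⟩ := hb.exists_pos_ne j k
  have := hb.add_add_le hj hk hl hjk h1.symm h2.symm
  omega

theorem add_one_le (hb : IsFacetWeight b) {j : V} (hj : 0 < b j) :
    b j + 1 ≤ (negOnes b).card := by
  obtain ⟨l, hl, h1, -⟩ := hb.exists_pos_ne j j
  have := hb.add_le hj hl h1.symm
  omega

end IsFacetWeight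

/-- The balancing part of a root: nodes of weight `-1` of prescribed number `r`, some forced in and
some forbidden. -/
theorem exists_subset_negOnes {V : Type*} [Fintype V] [DecidableEq V] {b : V → ℤ} (I E : Finset V)
    (hI : I ⊆ negOnes b) (hIE : Disjoint I E) {r : ℤ} (h1 : I.card ≤ r)
    (h2 : r + (E ∩ negOnes b).card ≤ (negOnes b).card) :
    ∃ K, I ⊆ K ∧ K ⊆ negOnes b ∧ Disjoint K E ∧ ∑ v ∈ K, b v = -r := by
  have hc : (negOnes b \ E).card + (E ∩ negOnes b).card = (negOnes b).card := by
    rw [Finset.inter_comm]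
    exact Finset.card_sdiff_add_card_inter _ _
  obtain ⟨K, hIK, hK, hr⟩ := Finset.exists_subsuperset_card_eq (s := I) (t := negOnes b \ E)
    (n := r.toNat) (Finset.subset_sdiff.2 ⟨hI, hIE⟩) (by omega) (by omega)
  obtain ⟨hK1, hK2⟩ := Finset.subset_sdiff.1 hK
  refine ⟨K, hIK, hK1, hK2, ?_⟩
  rw [Finset.sum_congr rfl fun v hv => mem_negOnes.1 (hK1 hv), Finset.sum_const, hr]
  simp
  omega

theorem exists_subset_negOnes_disjoint {V : Type*} [Fintype V] [DecidableEq V] {b : V → ℤ}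
    (E : Finset V) {r : ℤ} (h1 : 0 ≤ r) (h2 : r + (E ∩ negOnes b).card ≤ (negOnes b).card) :
    ∃ K, K ⊆ negOnes b ∧ Disjoint K E ∧ ∑ v ∈ K, b v = -r := by
  obtain ⟨K, -, h⟩ := exists_subset_negOnes ∅ E (by simp) (by simp) (by simpa using h1) h2
  exact ⟨K, h⟩

theorem notMem_of_subset_negOnes {V : Type*} [Fintype V] {b : V → ℤ} {K : Finset V}
    (hK : K ⊆ negOnes b) {v : V} (hv : 0 ≤ b v) : v ∉ K := fun h => by
  have := mem_negOnes.1 (hK h)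
  omega

/-! ### Functionals determined by families of roots -/

namespace IsFacetWeight

variable {V : Type*} [Fintype V] [DecidableEq V] {b : V → ℤ}

/-- With `N` nodes of weight `-1`, three positive weights of at least `N - 1` each would give `3 (N
- 1) ≤ N + 1`, that is `N ≤ 2`; but `i`, `i'`, `v` are three such nodes. -/
theorem exists_pos_add_le (hb : IsFacetWeight b) {i i' v : V} (hi : b i = -1) (hi' : b i' = -1)
    (hii : i ≠ i') (hv : b v = -1) (h1 : v ≠ i) (h2 : v ≠ i') :
    ∃ k, 0 < b k ∧ b k + 2 ≤ (negOnes b).card := by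
  have hN : 3 ≤ (negOnes b).card := by
    have h : ({i, i', v} : Finset V) ⊆ negOnes b := by
      intro w
      simp only [Finset.mem_insert, Finset.mem_singleton, mem_negOnes]
      rintro (rfl | rfl | rfl) <;> assumption
    have := Finset.card_le_card h
    rwa [Finset.card_eq_three.2 ⟨i, i', v, hii, h1.symm, h2.symm, rfl⟩] at this
  obtain ⟨j, hj, -, -⟩ := hb.exists_pos_ne i i
  obtain ⟨k, hk, hkj, -⟩ := hb.exists_pos_ne j j
  obtain ⟨l, hl, hlj, hlk⟩ := hb.exists_pos_ne j k
  have := hb.add_add_le hj hk hl hkj.symm hlj.symm hlk.symm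
  by_contra! h
  have := h j hj
  have := h k hk
  have := h l hl
  omega

/-- A linear functional that vanishes on the roots avoiding `E` vanishes off `E`. -/
theorem eq_zero_of_sum_disjoint (hb : IsFacetWeight b) (E : Finset V) {c : V → ℝ}
    (hE : E.card ≤ 2) {v : V} (hvE : v ∉ E)
    (hk : ∀ v, v ∉ E → b v = -1 → ∃ k, 0 < b k ∧ k ∉ E ∧
      b k + (E ∩ negOnes b).card ≤ (negOnes b).card)
    (h : ∀ S, IsHypermetricRoot b S → Disjoint S E → ∑ v ∈ S, c v = 0) : c v = 0 := by
  have hneg : ∀ v, v ∉ E → b v = -1 → c v = 0 := by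
    intro v hvE hv
    obtain ⟨k, hk0, hkE, hk⟩ := hk v hvE hv
    have hcard : (insert v E ∩ negOnes b).card ≤ (E ∩ negOnes b).card + 1 := by
      rw [Finset.insert_inter_of_mem (mem_negOnes.2 hv)]
      exact Finset.card_insert_le _ _
    -- With `b k - 1` balancing nodes, `insert k K` has weight `1`, and adding `v` gives weight `0`:
    -- both are roots, and they differ only in `v`.
    obtain ⟨K, hK, hKE, hKs⟩ := exists_subset_negOnes_disjoint (b := b) (insert v E)
      (r := b k - 1) (by omega) (by omega)
    rw [Finset.disjoint_insert_right] at hKE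
    have hkK : k ∉ K := notMem_of_subset_negOnes hK hk0.le
    have hvk : v ≠ k := by rintro rfl; omega
    have hvK : v ∉ insert k K := by simp [hvk, hKE.1]
    have hd : Disjoint (insert k K) E := Finset.disjoint_insert_left.2 ⟨hkE, hKE.2⟩
    have e1 := h (insert k K) (Or.inr (by rw [Finset.sum_insert hkK]; omega)) hd
    have e2 := h (insert v (insert k K))
      (Or.inl (by rw [Finset.sum_insert hvK, Finset.sum_insert hkK]; omega))
      (Finset.disjoint_insert_left.2 ⟨hvE, hd⟩)
    rw [Finset.sum_insert hvK, e1] at e2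
    simpa using e2
  rcases hb.trichotomy v with hv | hv | hv
  · exact hneg v hvE hv
  · simpa using h {v} (Or.inl (by simpa using hv)) (by simpa using hvE)
  · have h1 := hb.add_one_le hv
    have h2 : (E ∩ negOnes b).card ≤ 2 := (Finset.card_le_card Finset.inter_subset_left).trans hE
    obtain ⟨K, hK, hKE, hKs⟩ := exists_subset_negOnes_disjoint (b := b) E
      (r := b v - 1) (by omega) (by omega)
    have hvK : v ∉ K := notMem_of_subset_negOnes hK hv.le
    have e := h (insert v K) (Or.inr (by rw [Finset.sum_insert hvK]; omega))
      (Finset.disjoint_insert_left.2 ⟨hvE, hKE⟩)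
    rw [Finset.sum_insert hvK, Finset.sum_eq_zero fun w hw =>
      hneg w (Finset.disjoint_left.1 hKE hw) (mem_negOnes.1 (hK hw))] at e
    simpa using e

/-- A linear functional that is constant on the roots containing `i` but not `i'`, where `i` has
positive and `i'` negative weight, vanishes off `i` and `i'`. -/
theorem eq_zero_of_sum_separating (hb : IsFacetWeight b) {i i' : V} (hi : 0 < b i)
    (hi' : b i' = -1) {c : V → ℝ} {C : ℝ} {v : V} (hvi : v ≠ i) (hvi' : v ≠ i')
    (h : ∀ S, IsHypermetricRoot b S → i ∈ S → i' ∉ S → ∑ v ∈ S, c v = C) : c v = 0 := by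
  have hii : i' ≠ i := by rintro rfl; omega
  have hi1 := hb.add_one_le hi
  have hcard (E : Finset V) : (E ∩ negOnes b).card ≤ E.card :=
    Finset.card_le_card Finset.inter_subset_left
  have hneg : ∀ v, v ≠ i' → b v = -1 → c v = 0 := by
    intro v hvi' hv
    have h1 := hcard {i', v}
    have h2 := Finset.card_le_two (a := i') (b := v)
    obtain ⟨K, hK, hKE, hKs⟩ := exists_subset_negOnes_disjoint (b := b) {i', v}
      (r := b i - 1) (by omega) (by omega)
    simp only [Finset.disjoint_insert_right, Finset.disjoint_singleton_right] at hKE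
    have hiK : i ∉ K := notMem_of_subset_negOnes hK hi.le
    have hvi : v ≠ i := by rintro rfl; omega
    have hvK : v ∉ insert i K := by simp [hvi, hKE.2]
    have e1 := h (insert i K) (Or.inr (by rw [Finset.sum_insert hiK]; omega)) (by simp)
      (by simp [hii, hKE.1])
    have e2 := h (insert v (insert i K))
      (Or.inl (by rw [Finset.sum_insert hvK, Finset.sum_insert hiK]; omega)) (by simp)
      (by simp [hii, hKE.1, hvi'.symm])
    rw [Finset.sum_insert hvK, e1] at e2
    simpa using e2
  have hE1 : (({i'} : Finset V) ∩ negOnes b).card ≤ 1 := by simpa using hcard {i'}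
  obtain ⟨K, hK, hKE, hKs⟩ := exists_subset_negOnes_disjoint (b := b) {i'}
    (r := b i - 1) (by omega) (by omega)
  rw [Finset.disjoint_singleton_right] at hKE
  have hiK : i ∉ K := notMem_of_subset_negOnes hK hi.le
  have e1 := h (insert i K) (Or.inr (by rw [Finset.sum_insert hiK]; omega)) (by simp)
      (by simp [hii, hKE])
  rcases hb.trichotomy v with hv | hv | hv
  · exact hneg v hvi' hv
  · have hvK : v ∉ insert i K := by simp [hvi, notMem_of_subset_negOnes hK hv.ge]
    have e2 := h (insert v (insert i K))
      (Or.inr (by rw [Finset.sum_insert hvK, Finset.sum_insert hiK]; omega)) (by simp)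
      (by simp [hii, hKE, hvi'.symm])
    rw [Finset.sum_insert hvK, e1] at e2
    simpa using e2
  -- A positive `v` cannot simply be added to a root, so the balancing set is enlarged with it; the
  -- balancing nodes do not contribute to the functional.
  · have h1 := hb.add_le hi hv hvi.symm
    obtain ⟨M, hM, hME, hMs⟩ := exists_subset_negOnes_disjoint (b := b) {i'}
      (r := b i + b v - 1) (by omega) (by omega)
    rw [Finset.disjoint_singleton_right] at hME
    have hiM : i ∉ M := notMem_of_subset_negOnes hM hi.le
    have hvM : v ∉ insert i M := by simp [hvi, notMem_of_subset_negOnes hM hv.le]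
    have e2 := h (insert v (insert i M))
      (Or.inr (by rw [Finset.sum_insert hvM, Finset.sum_insert hiM]; omega)) (by simp)
      (by simp [hii, hME, hvi'.symm])
    have z (M : Finset V) (hM : M ⊆ negOnes b) (hi' : i' ∉ M) : ∑ v ∈ M, c v = 0 :=
      Finset.sum_eq_zero fun w hw => hneg w (by rintro rfl; exact hi' hw) (mem_negOnes.1 (hM hw))
    rw [Finset.sum_insert hiK, z K hK hKE] at e1
    rw [Finset.sum_insert hvM, Finset.sum_insert hiM, z M hM hME] at e2
    linarith

/-- The functionals that compare the roots obtained by adding `u` or `u'`, both of weight `-1`,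
to a set vanish off `u` and `u'`. -/
theorem eq_zero_of_sum_exchange (hb : IsFacetWeight b) {u u' : V} (hu : b u = -1)
    (hu' : b u' = -1) (huu : u ≠ u') {c : V → ℝ} {C : ℝ} {v : V} (hvu : v ≠ u) (hvu' : v ≠ u')
    (h : ∀ S, (∑ v ∈ S, b v = 1 ∨ ∑ v ∈ S, b v = 2) → u ∉ S → u' ∉ S → ∑ v ∈ S, c v = C) :
    c v = 0 := by
  have hcard (E : Finset V) : (E ∩ negOnes b).card ≤ E.card :=
    Finset.card_le_card Finset.inter_subset_left
  have hneg : ∀ v, v ≠ u → v ≠ u' → b v = -1 → c v = 0 := by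
    intro v hvu hvu' hv
    have h1 := hcard {u, u', v}
    have h2 := Finset.card_le_three (a := u) (b := u') (c := v)
    -- Positive weight at least `2` is needed to reach totals `2` and `1` without and with `v`. One
    -- node of weight at least `2` suffices, otherwise two of weight `1`. The upper bound leaves
    -- room to avoid `u`, `u'` and `v`.
    obtain ⟨T, hT, hT2, hTN⟩ : ∃ T : Finset V, (∀ t ∈ T, 0 < b t) ∧ 2 ≤ ∑ t ∈ T, b t ∧
        ∑ t ∈ T, b t + 1 ≤ (negOnes b).card := by
      have hN : 3 ≤ (negOnes b).card := by
        have h : ({u, u', v} : Finset V) ⊆ negOnes b := by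
          intro w
          simp only [Finset.mem_insert, Finset.mem_singleton, mem_negOnes]
          rintro (rfl | rfl | rfl) <;> assumption
        have := Finset.card_le_card h
        rwa [Finset.card_eq_three.2 ⟨u, u', v, huu, hvu.symm, hvu'.symm, rfl⟩] at this
      obtain ⟨j, hj, -, -⟩ := hb.exists_pos_ne u u
      obtain ⟨k, hk, hkj, -⟩ := hb.exists_pos_ne j j
      have hj1 := hb.add_one_le hj
      have hk1 := hb.add_one_le hk
      by_cases hj2 : 2 ≤ b j
      · exact ⟨{j}, by simpa using hj, by simpa using hj2, by simpa using hj1⟩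
      by_cases hk2 : 2 ≤ b k
      · exact ⟨{k}, by simpa using hk, by simpa using hk2, by simpa using hk1⟩
      refine ⟨{j, k}, by simp [hj, hk], ?_, ?_⟩ <;> rw [Finset.sum_pair hkj.symm] <;> omega
    obtain ⟨K, hK, hKE, hKs⟩ := exists_subset_negOnes_disjoint (b := b) {u, u', v}
      (r := ∑ t ∈ T, b t - 2) (by omega) (by omega)
    simp only [Finset.disjoint_insert_right, Finset.disjoint_singleton_right] at hKE
    have hTn : ∀ w, b w = -1 → w ∉ T := fun w hw hwT => by have := hT w hwT; omega
    have hTK : Disjoint T K := Finset.disjoint_right.2 fun w hw => hTn w (mem_negOnes.1 (hK hw))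
    have hm : ∀ w, b w = -1 → w ∉ K → w ∉ T ∪ K := fun w hw hwK => by simp [hTn w hw, hwK]
    have hvK := hm v hv hKE.2.2
    have e1 := h (T ∪ K) (Or.inr (by rw [Finset.sum_union hTK]; omega)) (hm u hu hKE.1)
      (hm u' hu' hKE.2.1)
    have e2 := h (insert v (T ∪ K))
      (Or.inl (by rw [Finset.sum_insert hvK, Finset.sum_union hTK]; omega))
      (by rw [Finset.mem_insert, not_or]; exact ⟨hvu.symm, hm u hu hKE.1⟩)
      (by rw [Finset.mem_insert, not_or]; exact ⟨hvu'.symm, hm u' hu' hKE.2.1⟩)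
    rw [Finset.sum_insert hvK, e1] at e2
    simpa using e2
  obtain ⟨k, hk, hkv, -⟩ := hb.exists_pos_ne v v
  have hk1 := hb.add_one_le hk
  have h1 := hcard {u, u'}
  have h2 := Finset.card_le_two (a := u) (b := u')
  obtain ⟨K, hK, hKE, hKs⟩ := exists_subset_negOnes_disjoint (b := b) {u, u'}
    (r := b k - 1) (by omega) (by omega)
  simp only [Finset.disjoint_insert_right, Finset.disjoint_singleton_right] at hKE
  have huk : u ≠ k := by rintro rfl; omega
  have huk' : u' ≠ k := by rintro rfl; omega
  have hkK : k ∉ K := notMem_of_subset_negOnes hK hk.le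
  have e1 := h (insert k K) (Or.inl (by rw [Finset.sum_insert hkK]; omega))
    (by simp [huk, hKE.1]) (by simp [huk', hKE.2])
  rcases hb.trichotomy v with hv | hv | hv
  · exact hneg v hvu hvu' hv
  · have hvK : v ∉ insert k K := by simp [hkv.symm, notMem_of_subset_negOnes hK hv.ge]
    have e2 := h (insert v (insert k K))
      (Or.inl (by rw [Finset.sum_insert hvK, Finset.sum_insert hkK]; omega))
      (by simp [huk, hKE.1, hvu.symm]) (by simp [huk', hKE.2, hvu'.symm])
    rw [Finset.sum_insert hvK, e1] at e2
    simpa using e2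
  · have h3 := hb.add_le hk hv hkv
    obtain ⟨M, hM, hME, hMs⟩ := exists_subset_negOnes_disjoint (b := b) {u, u'}
      (r := b k + b v - 2) (by omega) (by omega)
    simp only [Finset.disjoint_insert_right, Finset.disjoint_singleton_right] at hME
    have hkM : k ∉ M := notMem_of_subset_negOnes hM hk.le
    have hvM : v ∉ insert k M := by simp [hkv.symm, notMem_of_subset_negOnes hM hv.le]
    have e2 := h (insert v (insert k M))
      (Or.inr (by rw [Finset.sum_insert hvM, Finset.sum_insert hkM]; omega))
      (by simp [huk, hME.1, hvu.symm]) (by simp [huk', hME.2, hvu'.symm])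
    have z (M : Finset V) (hM : M ⊆ negOnes b) (h1 : u ∉ M) (h2 : u' ∉ M) :
        ∑ v ∈ M, c v = 0 :=
      Finset.sum_eq_zero fun w hw => hneg w (by rintro rfl; exact h1 hw)
        (by rintro rfl; exact h2 hw) (mem_negOnes.1 (hM hw))
    rw [Finset.sum_insert hkK, z K hK hKE.1 hKE.2] at e1
    rw [Finset.sum_insert hvM, Finset.sum_insert hkM, z M hM hME.1 hME.2] at e2
    linarith

end IsFacetWeight

/-! ### Hypermetric values of cuts, and the row of a new node -/

/-- The left hand side of the hypermetric inequality of `b` on the cut of `S`. -/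
theorem cutWeight_mul {V : Type*} [Fintype V] [DecidableEq V] {b : V → ℤ} (hb : ∑ v, b v = 1)
    (S : Finset V) : cutWeight (fun u v => (b u * b v : ℝ)) S =
      (((∑ v ∈ S, b v) * (1 - ∑ v ∈ S, b v) : ℤ) : ℝ) := by
  have h1 : ((∑ v ∈ S, b v : ℤ) : ℝ) + ((∑ v ∈ Sᶜ, b v : ℤ) : ℝ) = 1 := by
    have := Finset.sum_add_sum_compl S b
    rw [hb] at this
    exact_mod_cast this
  unfold cutWeight
  rw [← Finset.sum_mul_sum]
  push_cast at h1 ⊢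
  rw [← h1]
  ring

namespace IsFacetWeight

variable {V : Type*} [Fintype V] [DecidableEq V] {b : V → ℤ}

theorem two_le_card_negOnes (hb : IsFacetWeight b) : 2 ≤ (negOnes b).card := by
  obtain ⟨j, hj⟩ := Finset.card_pos.1 (zero_lt_three.trans_le hb.three_le)
  replace hj := (Finset.mem_filter.1 hj).2
  have := hb.add_one_le hj
  omega

theorem mul_neg_cases {V : Type*} [Fintype V] {b : V → ℤ} (hb : IsFacetWeight b) {i i' : V}
    (h : b i * b i' < 0) :
    (0 < b i ∧ b i' = -1) ∨ (b i = -1 ∧ 0 < b i') := by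
  rcases hb.trichotomy i with h1 | h1 | h1 <;> rcases hb.trichotomy i' with h2 | h2 | h2 <;>
    first
    | (left; exact ⟨h1, h2⟩)
    | (right; exact ⟨h1, h2⟩)
    | (exfalso; simp [h1, h2] at h)
    | (exfalso; nlinarith)

theorem mul_pos_cases {V : Type*} [Fintype V] {b : V → ℤ} (hb : IsFacetWeight b) {i i' : V}
    (h : 0 < b i * b i') :
    (0 < b i ∧ 0 < b i') ∨ (b i = -1 ∧ b i' = -1) := by
  rcases hb.trichotomy i with h1 | h1 | h1 <;> rcases hb.trichotomy i' with h2 | h2 | h2 <;>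
    first
    | (left; exact ⟨h1, h2⟩)
    | (right; exact ⟨h1, h2⟩)
    | (exfalso; simp [h1, h2] at h; done)
    | (exfalso; simp [h1, h2] at h; omega)

/-- For opposite signs, slack roots separate `i` and `i'`. Once the row is supported on these two
nodes, a root containing only `i` of them says that `c i` is half of `c i + c i'`. -/
theorem sum_row_aux (hb : IsFacetWeight b) {i i' : V} (hi : 0 < b i) (hi' : b i' = -1) {c : V → ℝ}
    (h : ∀ S, IsHypermetricRoot b S → IsSlack b i i' S → ∑ v ∈ S, c v = (∑ v, c v) / 2) :
    (∀ v, v ≠ i → v ≠ i' → c v = 0) ∧ c i' = c i := by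
  have hii : i ≠ i' := by rintro rfl; omega
  have h' : ∀ S, IsHypermetricRoot b S → i ∈ S → i' ∉ S → ∑ v ∈ S, c v = (∑ v, c v) / 2 := by
    refine fun S hS h1 h2 => h S hS ⟨fun hlt => ?_, fun _ => by tauto⟩
    rw [hi'] at hlt
    omega
  have hz : ∀ v, v ≠ i → v ≠ i' → c v = 0 := fun v h1 h2 =>
    hb.eq_zero_of_sum_separating hi hi' h1 h2 h'
  refine ⟨hz, ?_⟩
  have hi1 := hb.add_one_le hi
  have hc : (({i'} : Finset V) ∩ negOnes b).card ≤ 1 := by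
    simpa using Finset.card_le_card (Finset.inter_subset_left (s₁ := {i'}) (s₂ := negOnes b))
  obtain ⟨K, hK, hKE, hKs⟩ := exists_subset_negOnes_disjoint (b := b) {i'}
    (r := b i - 1) (by omega) (by omega)
  rw [Finset.disjoint_singleton_right] at hKE
  have hiK : i ∉ K := notMem_of_subset_negOnes hK hi.le
  have e := h' (insert i K) (Or.inr (by rw [Finset.sum_insert hiK]; omega)) (by simp)
    (by simp [hii.symm, hKE])
  have hKz : ∑ v ∈ K, c v = 0 := Finset.sum_eq_zero fun w hw =>
    hz w (by rintro rfl; exact hiK hw) (by rintro rfl; exact hKE hw)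
  rw [Finset.sum_insert hiK, hKz, Fintype.sum_eq_add i i' hii fun v hv => hz v hv.1 hv.2] at e
  linarith

/-- The shape of a row of coefficients that is balanced on all roots that leave a node attached
to `i` and `i'` free. -/
theorem sum_row (hb : IsFacetWeight b) {i i' : V} (hii : i ≠ i') {c : V → ℝ}
    (h : ∀ S, IsHypermetricRoot b S → IsSlack b i i' S → ∑ v ∈ S, c v = (∑ v, c v) / 2) :
    (∀ v, v ≠ i → v ≠ i' → c v = 0) ∧ (b i * b i' = 0 → c i = 0 ∧ c i' = 0) ∧
      (0 < b i * b i' → c i' = -c i) ∧ (b i * b i' < 0 → c i' = c i) := by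
  rcases lt_trichotomy (b i * b i') 0 with hlt | heq | hgt
  · have key : (∀ v, v ≠ i → v ≠ i' → c v = 0) ∧ c i' = c i := by
      rcases hb.mul_neg_cases hlt with ⟨h1, h2⟩ | ⟨h1, h2⟩
      · exact hb.sum_row_aux h1 h2 h
      · obtain ⟨h3, h4⟩ := hb.sum_row_aux h2 h1 fun S hS hsl => h S hS hsl.swap
        exact ⟨fun v hv hv' => h3 v hv' hv, h4.symm⟩
    exact ⟨key.1, fun h => absurd h hlt.ne, fun h => absurd h hlt.not_gt, fun _ => key.2⟩
  · have hs : ∀ S, IsSlack b i i' S := fun S =>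
      ⟨fun h => absurd h heq.not_gt, fun h => absurd h heq.not_lt⟩
    -- The empty set is a slack root, so the row has total zero, and every sum over a root vanishes.
    have h0 : (∑ v, c v) / 2 = 0 := by simpa using (h ∅ (isHypermetricRoot_empty b) (hs ∅)).symm
    have hz : ∀ v, c v = 0 := fun v =>
      hb.eq_zero_of_sum_disjoint ∅ (by simp) (by simp)
        (fun _ _ _ => by
          obtain ⟨k, hk, -, -⟩ := hb.exists_pos_ne i i
          have := hb.add_one_le hk
          exact ⟨k, hk, by simp, by simp; omega⟩)
        fun S hS _ => by rw [h S hS (hs S), h0]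
    exact ⟨fun v _ _ => hz v, fun _ => ⟨hz i, hz i'⟩, fun _ => by simp [hz], fun _ => by simp [hz]⟩
  · have hs : ∀ S, Disjoint S {i, i'} → IsSlack b i i' S := by
      intro S hS
      simp only [Finset.disjoint_insert_right, Finset.disjoint_singleton_right] at hS
      exact ⟨fun _ => by tauto, fun h => absurd h hgt.not_gt⟩
    have h0 : (∑ v, c v) / 2 = 0 := by
      simpa using (h ∅ (isHypermetricRoot_empty b) (hs ∅ (by simp))).symm
    have hz : ∀ v, v ≠ i → v ≠ i' → c v = 0 := fun v hv hv' => by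
      refine hb.eq_zero_of_sum_disjoint {i, i'} Finset.card_le_two (by simp [hv, hv']) ?_
        fun S hS hd => by rw [h S hS (hs S hd), h0]
      intro w hw hwn
      simp only [Finset.mem_insert, Finset.mem_singleton, not_or] at hw
      rcases hb.mul_pos_cases hgt with ⟨h1, h2⟩ | ⟨h1, h2⟩
      · obtain ⟨k, hk, hki, hki'⟩ := hb.exists_pos_ne i i'
        have := hb.add_one_le hk
        refine ⟨k, hk, by simp [hki, hki'], ?_⟩
        rw [Finset.disjoint_iff_inter_eq_empty.1]
        · simp; omega
        · rw [Finset.disjoint_left]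
          simp only [Finset.mem_insert, Finset.mem_singleton, mem_negOnes]
          rintro _ (rfl | rfl) <;> omega
      · obtain ⟨k, hk, hk2⟩ := hb.exists_pos_add_le h1 h2 hii hwn hw.1 hw.2
        refine ⟨k, hk, ?_, ?_⟩
        · simp only [Finset.mem_insert, Finset.mem_singleton, not_or]
          constructor <;> rintro rfl <;> omega
        · have := (Finset.card_le_card (Finset.inter_subset_left (s₁ := {i, i'})
            (s₂ := negOnes b))).trans Finset.card_le_two
          omega
    have hsum : ∑ v, c v = c i + c i' := Fintype.sum_eq_add i i' hii fun v hv => hz v hv.1 hv.2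
    exact ⟨hz, fun h => absurd h hgt.ne', fun _ => by linarith, fun h => absurd h hgt.not_gt⟩

/-- A root containing `j` but not `j'` is made from `j` and either `b j` or `b j - 1` nodes of
weight `-1`. This choice leaves room to place `i` and `i'` as their signs require. -/
theorem exists_isSlack_isSlack_aux (hb : IsFacetWeight b) {i i' j j' : V} (hj : 0 < b j)
    (hj' : b j' = -1) (hij : i ≠ j) (hij' : i ≠ j') (hi'j : i' ≠ j) (hi'j' : i' ≠ j') :
    ∃ S, IsHypermetricRoot b S ∧ IsSlack b i i' S ∧ IsSlack b j j' S := by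
  have hj1 := hb.add_one_le hj
  have hjj : j' ≠ j := by rintro rfl; omega
  have hcard (E : Finset V) : (E ∩ negOnes b).card ≤ E.card :=
    Finset.card_le_card Finset.inter_subset_left
  have hs : ∀ K, K ⊆ negOnes b → j' ∉ K → IsSlack b j j' (insert j K) := by
    refine fun K hK h => ⟨fun hlt => ?_, fun _ => by simp [hjj, h]⟩
    rw [hj'] at hlt
    omega
  rcases lt_trichotomy (b i * b i') 0 with hlt | heq | hgt
  · have hne : i' ≠ i := by rintro rfl; nlinarith
    have aux : ∀ i i', 0 < b i → b i' = -1 → i ≠ j → i' ≠ j → i' ≠ j' → i' ≠ i →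
        ∃ S, IsHypermetricRoot b S ∧ IsSlack b i i' S ∧ IsSlack b j j' S := by
      intro i i' h1 h2 hij hi'j hi'j' hne
      have hc : (({j'} : Finset V) ∩ negOnes b).card ≤ 1 := by simpa using hcard {j'}
      -- Balancing `j` completely, with total `0`, makes the balancing set nonempty even when `b j =
      -- 1`, so it can contain `i'`.
      obtain ⟨K, hIK, hK, hKE, hKs⟩ := exists_subset_negOnes (b := b) {i'} {j'}
        (by simpa [mem_negOnes] using h2) (by simpa using hi'j') (r := b j)
        (by simp; omega) (by omega)
      rw [Finset.disjoint_singleton_right] at hKE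
      rw [Finset.singleton_subset_iff] at hIK
      have hjK : j ∉ K := notMem_of_subset_negOnes hK hj.le
      have hiK : i ∉ K := notMem_of_subset_negOnes hK h1.le
      refine ⟨insert j K, Or.inl (by rw [Finset.sum_insert hjK]; omega), ⟨fun hgt => ?_,
        fun _ => by simp [hij, hiK, hIK]⟩, hs K hK hKE⟩
      rw [h2] at hgt
      omega
    rcases hb.mul_neg_cases hlt with ⟨h1, h2⟩ | ⟨h1, h2⟩
    · exact aux i i' h1 h2 hij hi'j hi'j' hne
    · obtain ⟨S, h3, h4, h5⟩ := aux i' i h2 h1 hi'j hij hij' hne.symm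
      exact ⟨S, h3, h4.swap, h5⟩
  · have hc : (({j'} : Finset V) ∩ negOnes b).card ≤ 1 := by simpa using hcard {j'}
    obtain ⟨K, hK, hKE, hKs⟩ := exists_subset_negOnes_disjoint (b := b) {j'}
      (r := b j - 1) (by omega) (by omega)
    rw [Finset.disjoint_singleton_right] at hKE
    have hjK : j ∉ K := notMem_of_subset_negOnes hK hj.le
    exact ⟨insert j K, Or.inr (by rw [Finset.sum_insert hjK]; omega),
      ⟨fun h => absurd h heq.not_gt, fun h => absurd h heq.not_lt⟩, hs K hK hKE⟩
  · have hn : ¬b i * b i' < 0 := hgt.not_gt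
    rcases hb.mul_pos_cases hgt with ⟨h1, h2⟩ | ⟨h1, h2⟩
    · have hc : (({j'} : Finset V) ∩ negOnes b).card ≤ 1 := by simpa using hcard {j'}
      obtain ⟨K, hK, hKE, hKs⟩ := exists_subset_negOnes_disjoint (b := b) {j'}
        (r := b j - 1) (by omega) (by omega)
      rw [Finset.disjoint_singleton_right] at hKE
      have hjK : j ∉ K := notMem_of_subset_negOnes hK hj.le
      exact ⟨insert j K, Or.inr (by rw [Finset.sum_insert hjK]; omega),
        ⟨fun _ => by simp [hij, hi'j, notMem_of_subset_negOnes hK h1.le,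
          notMem_of_subset_negOnes hK h2.le], fun h => absurd h hn⟩, hs K hK hKE⟩
    · by_cases hj2 : 2 ≤ b j
      · have hc : (({j'} : Finset V) ∩ negOnes b).card ≤ 1 := by simpa using hcard {j'}
        have hc2 := Finset.card_le_two (a := i) (b := i')
        obtain ⟨K, hIK, hK, hKE, hKs⟩ := exists_subset_negOnes (b := b) {i, i'} {j'}
          (by simp [Finset.insert_subset_iff, mem_negOnes, h1, h2])
          (by simp [hij'.symm, hi'j'.symm]) (r := b j) (by omega) (by omega)
        rw [Finset.disjoint_singleton_right] at hKE
        have hjK : j ∉ K := notMem_of_subset_negOnes hK hj.le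
        simp only [Finset.insert_subset_iff, Finset.singleton_subset_iff] at hIK
        exact ⟨insert j K, Or.inl (by rw [Finset.sum_insert hjK]; omega),
          ⟨fun _ => by simp [hIK], fun h => absurd h hn⟩, hs K hK hKE⟩
      -- Here `b j = 1`, so `j` alone is a root, and it leaves out both `i` and `i'`.
      · exact ⟨insert j ∅, Or.inr (by simp; omega),
          ⟨fun _ => by simp [hij, hi'j], fun h => absurd h hn⟩, hs ∅ (by simp) (by simp)⟩

/-- For disjoint pairs there is a root that leaves the nodes attached to both of them free. -/
theorem exists_isSlack_isSlack (hb : IsFacetWeight b) {i i' j j' : V}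
    (hij : i ≠ j) (hij' : i ≠ j') (hi'j : i' ≠ j) (hi'j' : i' ≠ j') :
    ∃ S, IsHypermetricRoot b S ∧ IsSlack b i i' S ∧ IsSlack b j j' S := by
  have key : ∀ {i i' j j' : V}, i ≠ j → i ≠ j' → i' ≠ j → i' ≠ j' → b j * b j' < 0 →
      ∃ S, IsHypermetricRoot b S ∧ IsSlack b i i' S ∧ IsSlack b j j' S := by
    intro i i' j j' hij hij' hi'j hi'j' h
    rcases hb.mul_neg_cases h with ⟨h1, h2⟩ | ⟨h1, h2⟩
    · exact hb.exists_isSlack_isSlack_aux h1 h2 hij hij' hi'j hi'j'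
    · obtain ⟨S, h3, h4, h5⟩ := hb.exists_isSlack_isSlack_aux h2 h1 hij' hij hi'j' hi'j
      exact ⟨S, h3, h4, h5.swap⟩
  by_cases h2 : b j * b j' < 0
  · exact key hij hij' hi'j hi'j' h2
  by_cases h1 : b i * b i' < 0
  · obtain ⟨S, h3, h4, h5⟩ := key hij.symm hi'j.symm hij'.symm hi'j'.symm h1
    exact ⟨S, h3, h5, h4⟩
  exact ⟨∅, isHypermetricRoot_empty b, ⟨by simp, fun h => absurd h h1⟩,
    ⟨by simp, fun h => absurd h h2⟩⟩

/-! ### The hypermetric inequality on the complete graph is facet inducing -/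

theorem sum_eq_zero_of_negOnes {V : Type*} [Fintype V] {b : V → ℤ} {c : V → ℝ} {K : Finset V}
    (hK : K ⊆ negOnes b)
    (h : ∀ v, b v = -1 → c v = 0) : ∑ v ∈ K, c v = 0 :=
  Finset.sum_eq_zero fun w hw => h w (mem_negOnes.1 (hK hw))

theorem eq_zero_of_forall_sum (hb : IsFacetWeight b) {c : V → ℝ}
    (h : ∀ S, IsHypermetricRoot b S → ∑ v ∈ S, c v = 0) (v : V) : c v = 0 :=
  hb.eq_zero_of_sum_disjoint ∅ (by simp) (by simp)
    (fun w _ _ => by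
      obtain ⟨k, hk, -, -⟩ := hb.exists_pos_ne w w
      have := hb.add_one_le hk
      exact ⟨k, hk, by simp, by simp; omega⟩)
    fun S hS _ => h S hS

/-- A symmetric weighting whose negative-negative part vanishes and that is zero on all roots
is zero. -/
theorem eq_zero_of_cutWeight (hb : IsFacetWeight b) {g : V → V → ℝ} (hsymm : ∀ u v, g u v = g v u)
    (hdiag : ∀ u, g u u = 0) (hg : ∀ S, IsHypermetricRoot b S → cutWeight g S = 0)
    (hzero : ∀ u v, b u = 0 → g u v = 0) (hneg : ∀ u v, b u = -1 → b v = -1 → g u v = 0)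
    (hconst : ∀ u u' v, b u = -1 → b u' = -1 → 0 < b v → g u v = g u' v) (u v : V) :
    g u v = 0 := by
  obtain ⟨n, hn⟩ : ∃ n, b n = -1 := by
    obtain ⟨n, hn⟩ := Finset.card_pos.1 (show 0 < (negOnes b).card by
      have := hb.two_le_card_negOnes; omega)
    exact ⟨n, mem_negOnes.1 hn⟩
  -- Adding `n` to a root made of `k` and nodes of weight `-1` gives another root; among the nodes
  -- of the first root only `k` can have nonzero weight in the row of `n`.
  have h1 : ∀ k, 0 < b k → 2 * g n k = ∑ v, g n v := by
    intro k hk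
    have hk1 := hb.add_one_le hk
    have hc : (({n} : Finset V) ∩ negOnes b).card ≤ 1 := by
      simpa using Finset.card_le_card (Finset.inter_subset_left (s₁ := {n}) (s₂ := negOnes b))
    obtain ⟨K, hK, hKE, hKs⟩ := exists_subset_negOnes_disjoint (b := b) {n}
      (r := b k - 1) (by omega) (by omega)
    rw [Finset.disjoint_singleton_right] at hKE
    have hkK : k ∉ K := notMem_of_subset_negOnes hK hk.le
    have hnk : n ≠ k := by rintro rfl; omega
    have hnK : n ∉ insert k K := by simp [hnk, hKE]
    have e1 := hg (insert k K) (Or.inr (by rw [Finset.sum_insert hkK]; omega))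
    have e2 := hg (insert n (insert k K))
      (Or.inl (by rw [Finset.sum_insert hnK, Finset.sum_insert hkK]; omega))
    rw [cutWeight_insert hsymm hdiag hnK, e1, Finset.sum_insert hkK,
      sum_eq_zero_of_negOnes hK fun v hv => hneg n v hn hv] at e2
    linarith
  have h2 : ∀ k, 0 < b k → g n k = 0 := by
    obtain ⟨k₀, hk₀, -, -⟩ := hb.exists_pos_ne n n
    have hc : ∀ k, 0 < b k → g n k = g n k₀ := fun k hk => by linarith [h1 k hk, h1 k₀ hk₀]
    have hs : ∑ v, g n v = (Finset.univ.filter fun v => 0 < b v).card * g n k₀ := by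
      rw [← nsmul_eq_mul, ← Finset.sum_const, Finset.sum_filter]
      refine Finset.sum_congr rfl fun v _ => ?_
      rcases hb.trichotomy v with hv | hv | hv
      · simp [hv, hneg n v hn hv]
      · simp [hv, hsymm n v, hzero v n hv]
      · simp [hv, hc v hv]
    have h3 : (3 : ℝ) ≤ (Finset.univ.filter fun v => 0 < b v).card := by exact_mod_cast hb.three_le
    have h4 := h1 k₀ hk₀
    rw [hs] at h4
    -- If `P` is the number of positive nodes and `x` the common value, then `2 x = P x`. This
    -- forces `x = 0` because `P ≥ 3`.
    have h5 : ((Finset.univ.filter fun v => 0 < b v).card - 2 : ℝ) * g n k₀ = 0 := by linarith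
    have h6 : g n k₀ = 0 := (mul_eq_zero.1 h5).resolve_left (by linarith)
    exact fun k hk => (hc k hk).trans h6
  have h3 : ∀ u v, b u = -1 → g u v = 0 := by
    intro u v hu
    rcases hb.trichotomy v with hv | hv | hv
    · exact hneg u v hu hv
    · rw [hsymm, hzero v u hv]
    · rw [hconst u n v hu hn hv, h2 v hv]
  -- Rows of nodes of weight `-1` are now zero, so these nodes can be used freely to balance any set
  -- of positive nodes light enough to be balanced.
  have h4 : ∀ K, K ⊆ negOnes b → ∀ S, cutWeight g (K ∪ S) = cutWeight g S := by
    intro K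
    induction K using Finset.induction_on with
    | empty => simp
    | insert w K hw ih =>
      intro hK S
      obtain ⟨hw1, hK⟩ := Finset.insert_subset_iff.1 hK
      rw [Finset.insert_union, ← ih hK S]
      by_cases hm : w ∈ K ∪ S
      · rw [Finset.insert_eq_of_mem hm]
      · simp [cutWeight_insert hsymm hdiag hm, h3 w _ (mem_negOnes.1 hw1)]
  have h5 : ∀ T : Finset V, (∀ t ∈ T, 0 < b t) → 1 ≤ ∑ t ∈ T, b t →
      ∑ t ∈ T, b t ≤ (negOnes b).card → cutWeight g T = 0 := by
    intro T hT hT1 hT2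
    obtain ⟨K, hK, -, hKs⟩ := exists_subset_negOnes_disjoint (b := b) ∅
      (r := ∑ t ∈ T, b t) (by omega) (by simpa using hT2)
    have hd : Disjoint K T := Finset.disjoint_right.2 fun t ht =>
      notMem_of_subset_negOnes hK (hT t ht).le
    rw [← h4 K hK T]
    exact hg _ (Or.inl (by rw [Finset.sum_union hd]; omega))
  have h0 : cutWeight g ∅ = 0 := by simp [cutWeight]
  have h6 : ∀ k, 0 < b k → ∑ v, g k v = 0 := by
    intro k hk
    have hk1 := hb.add_one_le hk
    have e := h5 {k} (by simpa using hk) (by simp; omega) (by simp; omega)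
    rw [← insert_empty_eq, cutWeight_insert hsymm hdiag (by simp), h0] at e
    simpa using e
  rcases hb.trichotomy u with hu | hu | hu
  · exact h3 u v hu
  · exact hzero u v hu
  rcases hb.trichotomy v with hv | hv | hv
  · rw [hsymm, h3 v u hv]
  · rw [hsymm, hzero v u hv]
  by_cases huv : u = v
  · rw [huv, hdiag]
  have huv1 := hb.add_le hu hv huv
  -- Since the rows of `u` and `v` have total zero, the cut of the pair has weight `-2 * g u v`.
  have e := h5 {u, v} (by simp [hu, hv]) (by rw [Finset.sum_pair huv]; omega)
    (by rw [Finset.sum_pair huv]; omega)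
  rw [cutWeight_insert hsymm hdiag (by simpa using huv), ← insert_empty_eq,
    cutWeight_insert hsymm hdiag (by simp), h0, h6 u hu, h6 v hv] at e
  simpa using e

/-- The hypermetric inequality of `b` induces a facet: a weighting that is zero on all its roots
is a multiple of it. -/
theorem exists_eq_mul_of_cutWeight (hb : IsFacetWeight b) {g : V → V → ℝ}
    (hsymm : ∀ u v, g u v = g v u) (hdiag : ∀ u, g u u = 0)
    (hg : ∀ S, IsHypermetricRoot b S → cutWeight g S = 0) :
    ∃ r : ℝ, ∀ u v, u ≠ v → g u v = r * (b u * b v) := by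
  have hzero : ∀ z v, b z = 0 → g z v = 0 := by
    intro z v hz
    -- A node of weight `0` can be put in or taken out of any root.
    have hrow : ∀ S, IsHypermetricRoot b S → ∑ v ∈ S, g z v = (∑ v, g z v) / 2 := by
      intro S hS
      have hS' : ∑ v ∈ S.erase z, b v = ∑ v ∈ S, b v := Finset.sum_erase _ hz
      have hzS : z ∉ S.erase z := by simp
      have e1 := hg (S.erase z) (by unfold IsHypermetricRoot; rwa [hS'])
      have e2 := hg (insert z (S.erase z))
        (by unfold IsHypermetricRoot; rw [Finset.sum_insert hzS, hz, zero_add, hS']; exact hS)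
      rw [cutWeight_insert hsymm hdiag hzS, e1, Finset.sum_erase _ (hdiag z)] at e2
      linarith
    have h0 : (∑ v, g z v) / 2 = 0 := by simpa using (hrow ∅ (isHypermetricRoot_empty b)).symm
    exact hb.eq_zero_of_forall_sum (fun S hS => (hrow S hS).trans h0) v
  have hexch : ∀ u u' w, b u = -1 → b u' = -1 → w ≠ u → w ≠ u' → g u w = g u' w := by
    intro u u' w hu hu' hwu hwu'
    by_cases huu : u = u'
    · rw [huu]
    refine sub_eq_zero.1 (hb.eq_zero_of_sum_exchange hu hu' huu (c := fun w => g u w - g u' w)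
      (C := (∑ v, g u v - ∑ v, g u' v) / 2) hwu hwu' ?_)
    intro S hS h1 h2
    have hr : ∀ u, b u = -1 → u ∉ S → IsHypermetricRoot b (insert u S) := by
      intro u hu h
      unfold IsHypermetricRoot
      rw [Finset.sum_insert h]
      omega
    have e1 := hg _ (hr u hu h1)
    have e2 := hg _ (hr u' hu' h2)
    rw [cutWeight_insert hsymm hdiag h1] at e1
    rw [cutWeight_insert hsymm hdiag h2] at e2
    rw [Finset.sum_sub_distrib]
    linarith
  obtain ⟨n, hn, m, hm, hnm⟩ := Finset.one_lt_card.1 hb.two_le_card_negOnes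
  rw [mem_negOnes] at hn hm
  have hnegneg : ∀ u v, b u = -1 → b v = -1 → u ≠ v → g u v = g n m := by
    intro u v hu hv huv
    by_cases hvn : v = n
    · subst hvn
      rw [hsymm v m, hexch u m v hu hm huv.symm hnm]
    · rw [hexch u n v hu hn huv.symm hvn, hsymm n m, hsymm n v]
      exact hexch v m n hv hm (Ne.symm hvn) hnm
  -- The scalar is read off at `n`, `m`, where `b n * b m = 1`. Subtracting that multiple off the
  -- diagonal kills the edges between nodes of weight `-1`.
  refine ⟨g n m, fun u v huv => ?_⟩
  have key := hb.eq_zero_of_cutWeight (g := fun u v => if u = v then 0 else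
      g u v - g n m * (b u * b v)) (fun u v => by simp only [eq_comm, hsymm u v, mul_comm (b u : ℝ)])
    (by simp) ?_ ?_ ?_ ?_ u v
  · simp only [huv, if_false] at key
    linarith
  · intro S hS
    have h1 : cutWeight (fun u v => if u = v then 0 else g u v - g n m * (b u * b v : ℝ)) S =
        cutWeight g S - g n m * cutWeight (fun u v => (b u * b v : ℝ)) S := by
      unfold cutWeight
      simp only [Finset.mul_sum, ← Finset.sum_sub_distrib]
      refine Finset.sum_congr rfl fun u hu => Finset.sum_congr rfl fun v hv => ?_
      rw [if_neg]
      rintro rfl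
      exact Finset.mem_compl.1 hv hu
    rw [h1, hg S hS, cutWeight_mul hb.sum_eq]
    rcases hS with h | h <;> simp [h]
  · intro u v hu
    simp [hu, hzero u v hu]
  · intro u v hu hv
    by_cases h : u = v
    · simp [h]
    · simp [h, hu, hv, hnegneg u v hu hv h]
  · intro u u' v hu hu' hv
    have h1 : u ≠ v := by rintro rfl; omega
    have h2 : u' ≠ v := by rintro rfl; omega
    simp [h1, h2, hu, hu', hexch u u' v hu hu' h1.symm h2.symm]

end IsFacetWeight

/-! ### Triangular elimination: reduction to the complete graph -/

theorem sum_eq_ite_add_ite {V : Type*} [DecidableEq V] {c : V → ℝ} {i i' : V} (hii : i ≠ i')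
    (hc : ∀ v, v ≠ i → v ≠ i' → c v = 0) (A : Finset V) :
    ∑ v ∈ A, c v = (if i ∈ A then c i else 0) + (if i' ∈ A then c i' else 0) := by
  rw [← Finset.sum_ite_eq' A i c, ← Finset.sum_ite_eq' A i' c, ← Finset.sum_add_distrib]
  refine Finset.sum_congr rfl fun v _ => ?_
  by_cases h1 : v = i
  · subst h1; simp [hii]
  by_cases h2 : v = i'
  · subst h2; simp [h1]
  simp [h1, h2, hc v h1 h2]

theorem compl_disjSum {V W : Type*} [Fintype V] [DecidableEq V] [Fintype W] [DecidableEq W]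
    (S : Finset V) (T : Finset W) : (S.disjSum T)ᶜ = Sᶜ.disjSum Tᶜ := by
  ext (v | w) <;> simp

theorem insert_inr_disjSum {V W : Type*} [DecidableEq V] [DecidableEq W]
    (S : Finset V) (T : Finset W) (w : W) :
    insert (Sum.inr w) (S.disjSum T) = S.disjSum (insert w T) := by
  ext (v | w) <;> simp

/-- If a node `w` attached to `e₁ w` and `e₂ w` is always on the side of `e₂ w`, it only
contributes to the weight of the edge from `e₁ w` to `e₂ w`. -/
theorem cutWeight_disjSum_filter {V W : Type*} [Fintype V] [DecidableEq V] [Fintype W]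
    [DecidableEq W] {e₁ e₂ : W → V} (hne : ∀ w, e₁ w ≠ e₂ w) {g : V ⊕ W → V ⊕ W → ℝ}
    (hsymm : ∀ u v, g u v = g v u) (hW : ∀ w w', g (Sum.inr w) (Sum.inr w') = 0)
    (hrow : ∀ w v, v ≠ e₁ w → v ≠ e₂ w → g (Sum.inr w) (Sum.inl v) = 0) (S : Finset V) :
    cutWeight g (S.disjSum (Finset.univ.filter fun w => e₂ w ∈ S)) =
      cutWeight (fun u v => g (Sum.inl u) (Sum.inl v) +
        ∑ w, ((if u = e₁ w ∧ v = e₂ w then g (Sum.inr w) (Sum.inl (e₁ w)) else 0) +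
          (if u = e₂ w ∧ v = e₁ w then g (Sum.inr w) (Sum.inl (e₁ w)) else 0))) S := by
  have hsum : ∀ w (A : Finset V), ∑ v ∈ A, g (Sum.inr w) (Sum.inl v) =
      (if e₁ w ∈ A then g (Sum.inr w) (Sum.inl (e₁ w)) else 0) +
      (if e₂ w ∈ A then g (Sum.inr w) (Sum.inl (e₂ w)) else 0) := fun w A =>
    sum_eq_ite_add_ite (hne w) (hrow w) A
  have hpair : ∀ (r : ℝ) (i i' : V), ∑ u ∈ S, ∑ v ∈ Sᶜ, (if u = i ∧ v = i' then r else 0) =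
      if i ∈ S ∧ i' ∉ S then r else 0 := by
    intro r i i'
    simp [ite_and, Finset.sum_ite_eq']
  have hR : ∑ u ∈ S, ∑ v ∈ Sᶜ,
      ∑ w, ((if u = e₁ w ∧ v = e₂ w then g (Sum.inr w) (Sum.inl (e₁ w)) else 0) +
          (if u = e₂ w ∧ v = e₁ w then g (Sum.inr w) (Sum.inl (e₁ w)) else 0)) =
      ∑ w, ((if e₁ w ∈ S ∧ e₂ w ∉ S then g (Sum.inr w) (Sum.inl (e₁ w)) else 0) +
        (if e₂ w ∈ S ∧ e₁ w ∉ S then g (Sum.inr w) (Sum.inl (e₁ w)) else 0)) := by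
    rw [Finset.sum_congr rfl fun u _ => Finset.sum_comm, Finset.sum_comm]
    refine Finset.sum_congr rfl fun w _ => ?_
    simp only [Finset.sum_add_distrib, hpair]
  unfold cutWeight
  rw [compl_disjSum, Finset.sum_disjSum]
  simp only [Finset.sum_disjSum, hW, Finset.sum_const_zero, add_zero,
    Finset.sum_add_distrib (s := S), Finset.sum_add_distrib (s := Sᶜ)]
  rw [hR, add_assoc]
  congr 1
  rw [Finset.sum_comm]
  simp only [hsymm (Sum.inl _) (Sum.inr _), hsum, Finset.compl_filter, Finset.sum_filter]
  rw [← Finset.sum_add_distrib]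
  refine Finset.sum_congr rfl fun w _ => ?_
  by_cases h1 : e₁ w ∈ S <;> by_cases h2 : e₂ w ∈ S <;> simp [h1, h2]

/-- Triangular elimination of the hypermetric inequality of `b`: a weighting that is zero on all
cuts that satisfy the resulting inequality with equality is a multiple of it. The node `w` is
attached to `e₁ w` and `e₂ w`. -/
theorem IsFacetWeight.exists_eq_mul_of_elimination {V W : Type*} [Fintype V] [DecidableEq V]
    [Fintype W] [DecidableEq W] {b : V → ℤ} (hb : IsFacetWeight b) {e₁ e₂ : W → V}
    (hne : ∀ w, e₁ w ≠ e₂ w) (hinj : ∀ w w', e₁ w = e₁ w' → e₂ w = e₂ w' → w = w')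
    (hswap : ∀ w w', e₁ w = e₂ w' → e₂ w ≠ e₁ w') {g : V ⊕ W → V ⊕ W → ℝ}
    (hsymm : ∀ u v, g u v = g v u) (hdiag : ∀ u, g u u = 0)
    (hedge : ∀ w, g (Sum.inl (e₁ w)) (Sum.inl (e₂ w)) = 0)
    (hpair : ∀ w w', g (Sum.inr w) (Sum.inr w') = 0 ∨
      (e₁ w ≠ e₁ w' ∧ e₁ w ≠ e₂ w' ∧ e₂ w ≠ e₁ w' ∧ e₂ w ≠ e₂ w'))
    (hg : ∀ S T, IsHypermetricRoot b S → (∀ w, IsSlack b (e₁ w) (e₂ w) S ∨ (w ∈ T ↔ e₂ w ∈ S)) →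
      cutWeight g (S.disjSum T) = 0) :
    (∀ w w', g (Sum.inr w) (Sum.inr w') = 0) ∧
    (∀ w v, v ≠ e₁ w → v ≠ e₂ w → g (Sum.inr w) (Sum.inl v) = 0) ∧
    ∃ r : ℝ, (∀ u v, u ≠ v → (∀ w, ¬(u = e₁ w ∧ v = e₂ w) ∧ ¬(u = e₂ w ∧ v = e₁ w)) →
        g (Sum.inl u) (Sum.inl v) = r * (b u * b v)) ∧
      ∀ w, g (Sum.inr w) (Sum.inl (e₁ w)) = r * (b (e₁ w) * b (e₂ w)) ∧
        g (Sum.inr w) (Sum.inl (e₂ w)) = -(r * |(b (e₁ w) * b (e₂ w) : ℝ)|) := by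
  -- Moving a free node `w` across the cut keeps equality, so the edges from `w` to one side carry
  -- half of its row.
  have hflip : ∀ S T w, IsHypermetricRoot b S → IsSlack b (e₁ w) (e₂ w) S → w ∉ T →
      (∀ x, x ≠ w → IsSlack b (e₁ x) (e₂ x) S ∨ (x ∈ T ↔ e₂ x ∈ S)) →
      ∑ v ∈ S, g (Sum.inr w) (Sum.inl v) + ∑ x ∈ T, g (Sum.inr w) (Sum.inr x) =
        (∑ v, g (Sum.inr w) v) / 2 := by
    intro S T w hS hw hwT h
    have e1 := hg S T hS fun x => by
      by_cases hx : x = w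
      · subst hx; exact Or.inl hw
      · exact h x hx
    have e2 := hg S (insert w T) hS fun x => by
      by_cases hx : x = w
      · subst hx; exact Or.inl hw
      · simpa [hx] using h x hx
    rw [← insert_inr_disjSum, cutWeight_insert hsymm hdiag (by simpa using hwT), e1,
      Finset.sum_disjSum] at e2
    linarith
  have hW : ∀ w w', g (Sum.inr w) (Sum.inr w') = 0 := by
    intro w w'
    rcases hpair w w' with h | ⟨h1, h2, h3, h4⟩
    · exact h
    obtain ⟨S, hS, hw, hw'⟩ := hb.exists_isSlack_isSlack h1 h2 h3 h4
    have hww : w ≠ w' := by rintro rfl; exact h1 rfl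
    -- Both `w` and `w'` are free here. Comparing the flip of `w` without and with `w'` in the set
    -- isolates the weight of the edge between them.
    set T := Finset.univ.filter fun x => x ≠ w ∧ x ≠ w' ∧ e₂ x ∈ S
    have hw'T : w' ∉ T := by simp [T]
    have e1 := hflip S T w hS hw (by simp [T]) fun x hx => by
      by_cases hx' : x = w'
      · subst hx'; exact Or.inl hw'
      · exact Or.inr (by simp [T, hx, hx'])
    have e2 := hflip S (insert w' T) w hS hw (by simp [T, hww]) fun x hx => by
      by_cases hx' : x = w'
      · subst hx'; exact Or.inl hw'
      · exact Or.inr (by simp [T, hx, hx'])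
    rw [Finset.sum_insert hw'T] at e2
    linarith
  have hrow : ∀ w S, IsHypermetricRoot b S → IsSlack b (e₁ w) (e₂ w) S →
      ∑ v ∈ S, g (Sum.inr w) (Sum.inl v) = (∑ v, g (Sum.inr w) (Sum.inl v)) / 2 := by
    intro w S hS hw
    have e := hflip S (Finset.univ.filter fun x => x ≠ w ∧ e₂ x ∈ S) w hS hw (by simp)
      fun x hx => Or.inr (by simp [hx])
    simpa [hW] using e
  have hrow' := fun w => hb.sum_row (hne w) (hrow w)
  refine ⟨hW, fun w => (hrow' w).1, ?_⟩
  -- When each `w` follows `e₂ w`, its edge to `e₁ w` acts as an edge from `e₂ w` to `e₁ w`, which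
  -- gives the collapsed weighting.
  obtain ⟨r, hr⟩ := hb.exists_eq_mul_of_cutWeight
    (g := fun u v => g (Sum.inl u) (Sum.inl v) +
        ∑ w, ((if u = e₁ w ∧ v = e₂ w then g (Sum.inr w) (Sum.inl (e₁ w)) else 0) +
          (if u = e₂ w ∧ v = e₁ w then g (Sum.inr w) (Sum.inl (e₁ w)) else 0)))
    (fun u v => by
      rw [hsymm (Sum.inl u)]
      congr 1
      refine Finset.sum_congr rfl fun w _ => ?_
      rw [add_comm]
      simp only [and_comm])
    (fun u => by
      rw [hdiag, zero_add]
      refine Finset.sum_eq_zero fun w _ => ?_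
      rw [if_neg, if_neg, add_zero]
      · rintro ⟨h1, h2⟩; exact hne w (h2.symm.trans h1)
      · rintro ⟨h1, h2⟩; exact hne w (h1.symm.trans h2))
    (fun S hS => by
      rw [← cutWeight_disjSum_filter hne hsymm hW fun w => (hrow' w).1]
      exact hg S _ hS fun w => Or.inr (by simp))
  -- The eliminated edge has weight zero in `g`, and no other new node belongs to the same pair, so
  -- the collapsed weight of this edge comes from `w` alone.
  have hfirst : ∀ w, g (Sum.inr w) (Sum.inl (e₁ w)) = r * (b (e₁ w) * b (e₂ w)) := by
    intro w
    rw [← hr (e₁ w) (e₂ w) (hne w), hedge, zero_add, Finset.sum_eq_single w]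
    · simp [hne w]
    · intro x _ hx
      rw [if_neg fun h => hx (hinj w x h.1 h.2).symm, if_neg fun h => hswap w x h.1 h.2, add_zero]
    · simp
  refine ⟨r, fun u v huv h => ?_, fun w => ⟨hfirst w, ?_⟩⟩
  · rw [← hr u v huv, Finset.sum_eq_zero, add_zero]
    intro w _
    rw [if_neg (h w).1, if_neg (h w).2, add_zero]
  · obtain ⟨-, h0, hp, hn⟩ := hrow' w
    rcases lt_trichotomy (b (e₁ w) * b (e₂ w)) 0 with h | h | h
    · have h' : (b (e₁ w) * b (e₂ w) : ℝ) < 0 := by exact_mod_cast h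
      rw [hn h, hfirst, abs_of_neg h']
      ring
    · have h' : (b (e₁ w) * b (e₂ w) : ℝ) = 0 := by exact_mod_cast h
      simp [(h0 h).2, h']
    · have h' : 0 < (b (e₁ w) * b (e₂ w) : ℝ) := by exact_mod_cast h
      rw [hp h, hfirst, abs_of_pos h']

/-! ### Linear forms as weightings of the tripartite graph -/

/-- The weighting of the complete tripartite graph with parts `{X}`, `α`, `β`. -/
def tripartiteWeight {α β : Type} (γ : BellVec α β) : Option (α ⊕ β) → Option (α ⊕ β) → ℝ
  | none, none => 0
  | none, some (Sum.inl a) => γ.atA a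
  | none, some (Sum.inr b) => γ.atB b
  | some (Sum.inl a), none => γ.atA a
  | some (Sum.inr b), none => γ.atB b
  | some (Sum.inl _), some (Sum.inl _) => 0
  | some (Sum.inl a), some (Sum.inr b) => γ.atAB a b
  | some (Sum.inr b), some (Sum.inl a) => γ.atAB a b
  | some (Sum.inr _), some (Sum.inr _) => 0

theorem tripartiteWeight_symm {α β : Type} (γ : BellVec α β) (u v : Option (α ⊕ β)) :
    tripartiteWeight γ u v = tripartiteWeight γ v u := by
  rcases u with _ | u | u <;> rcases v with _ | v | v <;> rfl

theorem tripartiteWeight_self {α β : Type} (γ : BellVec α β) (u : Option (α ⊕ β)) :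
    tripartiteWeight γ u u = 0 := by
  rcases u with _ | u | u <;> rfl

/-- The cut vector of `S` in the complete tripartite graph. -/
def cutVec {α β : Type} [DecidableEq α] [DecidableEq β] (S : Finset (Option (α ⊕ β))) : BellVec α β
  | Sum.inl a => if none ∈ S ↔ some (Sum.inl a) ∈ S then 0 else 1
  | Sum.inr (Sum.inl b) => if none ∈ S ↔ some (Sum.inr b) ∈ S then 0 else 1
  | Sum.inr (Sum.inr (a, b)) => if some (Sum.inl a) ∈ S ↔ some (Sum.inr b) ∈ S then 0 else 1

theorem cutWeight_eq_sum_ite {U : Type*} [Fintype U] [DecidableEq U] (g : U → U → ℝ)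
    (S : Finset U) : cutWeight g S = ∑ u, ∑ v, if u ∈ S ∧ v ∉ S then g u v else 0 := by
  unfold cutWeight
  rw [← Finset.sum_filter_add_sum_filter_not Finset.univ (· ∈ S) (fun u => ∑ v, _)]
  have h : ∀ u ∈ Finset.univ.filter (· ∉ S), (∑ v, if u ∈ S ∧ v ∉ S then g u v else 0) = 0 := by
    intro u hu
    simp [(Finset.mem_filter.1 hu).2]
  rw [Finset.sum_eq_zero h, add_zero, Finset.filter_mem_eq_inter, Finset.univ_inter]
  refine Finset.sum_congr rfl fun u hu => ?_
  simp only [hu, true_and]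
  rw [← Finset.sum_filter]
  congr 1
  ext
  simp

theorem cutWeight_tripartiteWeight {α β : Type} [Fintype α] [DecidableEq α] [Fintype β]
    [DecidableEq β] (γ : BellVec α β) (S : Finset (Option (α ⊕ β))) :
    cutWeight (tripartiteWeight γ) S = ∑ c, γ c * cutVec S c := by
  have h : ∀ (P Q : Prop) [Decidable P] [Decidable Q] (r : ℝ),
      (if P ∧ ¬Q then r else 0) + (if Q ∧ ¬P then r else 0) = r * (if P ↔ Q then 0 else 1) := by
    intro P Q _ _ r
    by_cases hP : P <;> by_cases hQ : Q <;> simp [hP, hQ]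
  rw [cutWeight_eq_sum_ite]
  simp only [Fintype.sum_option, Fintype.sum_sum_type, tripartiteWeight, ite_self,
    Finset.sum_const_zero, add_zero, zero_add, Fintype.sum_prod_type, Finset.sum_add_distrib]
  rw [Finset.sum_comm (s := (Finset.univ : Finset β)) (t := (Finset.univ : Finset α))]
  have e1 : ∀ a, γ (Sum.inl a) * cutVec S (Sum.inl a) =
      (if none ∈ S ∧ some (Sum.inl a) ∉ S then γ.atA a else 0) +
        if some (Sum.inl a) ∈ S ∧ none ∉ S then γ.atA a else 0 := fun _ => (h _ _ _).symm
  have e2 : ∀ b, γ (Sum.inr (Sum.inl b)) * cutVec S (Sum.inr (Sum.inl b)) =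
      (if none ∈ S ∧ some (Sum.inr b) ∉ S then γ.atB b else 0) +
        if some (Sum.inr b) ∈ S ∧ none ∉ S then γ.atB b else 0 := fun _ => (h _ _ _).symm
  have e3 : ∀ a b, γ (Sum.inr (Sum.inr (a, b))) * cutVec S (Sum.inr (Sum.inr (a, b))) =
      (if some (Sum.inl a) ∈ S ∧ some (Sum.inr b) ∉ S then γ.atAB a b else 0) +
        if some (Sum.inr b) ∈ S ∧ some (Sum.inl a) ∉ S then γ.atAB a b else 0 :=
    fun _ _ => (h _ _ _).symm
  simp only [e1, e2, e3, Finset.sum_add_distrib]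
  ring

theorem cutWeight_comp_equiv {U U' : Type*} [Fintype U] [DecidableEq U] [Fintype U']
    [DecidableEq U'] (φ : U ≃ U') (g : U' → U' → ℝ) (S : Finset U) :
    cutWeight (fun u v => g (φ u) (φ v)) S = cutWeight g (S.map φ.toEmbedding) := by
  rw [cutWeight_eq_sum_ite, cutWeight_eq_sum_ite, ← Equiv.sum_comp φ]
  refine Finset.sum_congr rfl fun u _ => ?_
  rw [← Equiv.sum_comp φ]
  simp

/-! ### The formula for the inequality in correlation coordinates -/

theorem sum_indexPair {n : ℕ} (f : Fin n → Fin n → ℝ) :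
    ∑ p : IndexPair n, f p.1.1 p.1.2 = ∑ i, ∑ j, if i < j then f i j else 0 := by
  rw [← Fintype.sum_prod_type' (f := fun i j => if i < j then f i j else 0), ← Finset.sum_filter]
  exact (Finset.sum_subtype _ (by simp) fun p : Fin n × Fin n => f p.1 p.2).symm

theorem sum_sum_eq_sum_indexPair {n : ℕ} (f : Fin n → Fin n → ℝ) :
    ∑ i, ∑ j, f i j = ∑ p : IndexPair n, (f p.1.1 p.1.2 + f p.1.2 p.1.1) + ∑ i, f i i := by
  have h : ∑ i, f i i = ∑ i, ∑ j, if i = j then f i j else 0 := by simp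
  rw [Finset.sum_add_distrib, sum_indexPair f, sum_indexPair fun i j => f j i, h]
  rw [Finset.sum_comm (f := fun i j => if i < j then f j i else 0)]
  simp only [← Finset.sum_add_distrib]
  refine Finset.sum_congr rfl fun i _ => Finset.sum_congr rfl fun j _ => ?_
  rcases lt_trichotomy i j with h | h | h
  · simp [h, h.ne, h.not_gt]
  · simp [h]
  · simp [h, h.ne', h.not_gt]

/-- An earlier index `j` contributes `-|b i * b j|` to the coefficient of `q i`. This is `b i * b j`
for opposite signs and `b i * b j - 2 * (b i * b j)` for equal signs. The terms `b i * b j` with `j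
≠ i` cancel against the factor `1 - ∑ b j`; what is left is `b i - b i ^ 2` and the correction from
earlier indices of the same sign. -/
theorem sum_linear_coeff {n : ℕ} (b : Fin n → ℤ) (q : Fin n → ℝ) :
    ∑ i, (1 - ∑ j, (b j : ℝ)) * b i * q i +
      ∑ p : IndexPair n, (b p.1.1 * b p.1.2 * q p.1.1 - |(b p.1.1 * b p.1.2 : ℝ)| * q p.1.2) =
    2 * (∑ i : Fin n with 0 < b i, (b i : ℝ) * ((1 - (b i : ℝ)) / 2
          - ∑ i' : Fin n with i' < i ∧ 0 < b i', (b i' : ℝ)) * q i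
      + ∑ i : Fin n with b i ≤ 0, (b i : ℝ) * ((1 - (b i : ℝ)) / 2
          - ∑ i' : Fin n with i' < i ∧ b i' ≤ 0, (b i' : ℝ)) * q i) := by
  have hle : (Finset.univ.filter fun i => b i ≤ 0) = Finset.univ.filter fun i => ¬0 < b i := by
    simp
  rw [hle, Finset.sum_filter, Finset.sum_filter, ← Finset.sum_add_distrib,
    sum_indexPair fun i j => (b i * b j * q i - |(b i * b j : ℝ)| * q j)]
  have hsplit : ∑ i, ∑ j, (if i < j then (b i * b j * q i - |(b i * b j : ℝ)| * q j) else 0) =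
      ∑ i, ∑ j, ((if i < j then (b i * b j : ℝ) else 0) -
        if j < i then |(b i * b j : ℝ)| else 0) * q i := by
    have h1 : ∀ i j, (if i < j then (b i * b j * q i - |(b i * b j : ℝ)| * q j) else 0) =
        (if i < j then (b i * b j : ℝ) else 0) * q i -
          (if i < j then |(b i * b j : ℝ)| else 0) * q j := by
      intro i j
      split_ifs <;> ring
    simp only [h1, sub_mul, Finset.sum_sub_distrib]
    congr 1
    rw [Finset.sum_comm]
    simp only [mul_comm]
  rw [hsplit, ← Finset.sum_add_distrib, Finset.mul_sum]
  refine Finset.sum_congr rfl fun i _ => ?_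
  rw [← Finset.sum_mul, ← add_mul]
  have hdiag : ∑ j, (if j = i then (b i * b i : ℝ) else 0) = b i * b i := by simp
  by_cases hi : 0 < b i
  · have hi' : (0 : ℝ) < b i := by exact_mod_cast hi
    simp only [hi, if_true, not_true, if_false, add_zero]
    rw [← mul_assoc]
    congr 1
    have key : ∑ j, ((if i < j then (b i * b j : ℝ) else 0) -
        (if j < i then |(b i * b j : ℝ)| else 0)) = b i * ∑ j, (b j : ℝ) -
        2 * (b i * ∑ i' : Fin n with i' < i ∧ 0 < b i', (b i' : ℝ)) -
        ∑ j, (if j = i then (b i * b i : ℝ) else 0) := by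
      rw [Finset.sum_filter]
      simp only [Finset.mul_sum, ← Finset.sum_sub_distrib]
      refine Finset.sum_congr rfl fun j _ => ?_
      rcases lt_trichotomy i j with h | rfl | h
      · simp [h, h.ne', h.not_gt]
      · simp
      · rcases lt_or_ge 0 (b j) with hj | hj
        · have : (0 : ℝ) < b j := by exact_mod_cast hj
          simp [h, h.ne, h.not_gt, hj, abs_of_pos (mul_pos hi' this)]
          ring
        · have : (b j : ℝ) ≤ 0 := by exact_mod_cast hj
          simp [h, h.ne, h.not_gt, hj.not_gt,
            abs_of_nonpos (mul_nonpos_of_nonneg_of_nonpos hi'.le this)]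
    rw [key, hdiag]
    ring
  · have hi' : (b i : ℝ) ≤ 0 := by exact_mod_cast not_lt.1 hi
    simp only [hi, if_false, not_false_eq_true, if_true, zero_add]
    rw [← mul_assoc]
    congr 1
    have key : ∑ j, ((if i < j then (b i * b j : ℝ) else 0) -
        (if j < i then |(b i * b j : ℝ)| else 0)) = b i * ∑ j, (b j : ℝ) -
        2 * (b i * ∑ i' : Fin n with i' < i ∧ b i' ≤ 0, (b i' : ℝ)) -
        ∑ j, (if j = i then (b i * b i : ℝ) else 0) := by
      rw [Finset.sum_filter]
      simp only [Finset.mul_sum, ← Finset.sum_sub_distrib]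
      refine Finset.sum_congr rfl fun j _ => ?_
      rcases lt_trichotomy i j with h | rfl | h
      · simp [h, h.ne', h.not_gt]
      · simp
      · rcases lt_or_ge 0 (b j) with hj | hj
        · have : (0 : ℝ) < b j := by exact_mod_cast hj
          simp [h, h.ne, h.not_gt, hj.not_ge,
            abs_of_nonpos (mul_nonpos_of_nonpos_of_nonneg hi' this.le)]
        · have : (b j : ℝ) ≤ 0 := by exact_mod_cast hj
          simp [h, h.ne, h.not_gt, hj, abs_of_nonneg (mul_nonneg_of_nonpos_of_nonpos hi' this)]
          ring
    rw [key, hdiag]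
    ring

theorem sum_mul_sub_abs {ι : Type*} [Fintype ι] (a : ι → ℤ) (q : ι → ℝ) :
    ∑ p, ((a p : ℝ) - |(a p : ℝ)|) * q p = 2 * ∑ p with a p < 0, (a p : ℝ) * q p := by
  rw [Finset.sum_filter, Finset.mul_sum]
  refine Finset.sum_congr rfl fun p _ => ?_
  split_ifs with h
  · rw [abs_of_neg (by exact_mod_cast h)]
    ring
  · rw [abs_of_nonneg (by exact_mod_cast not_lt.1 h)]
    ring

/-- Expanding `x_{AB} = q_A + q_B - 2 q_{AB}` on the edges `A_i B_j` produces one-party terms that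
cancel the other party's share of `b_X`. Each party is then handled separately by
`sum_linear_coeff`, and the new observables by `sum_mul_sub_abs`. -/
theorem triangularElimination_hypermetricCoeff {s t : ℕ} (bA : Fin s → ℤ) (bB : Fin t → ℤ)
    (q : BellVec (ElimA s t) (ElimB s t)) :
    triangularElimination (hypermetricCoeff bA bB) (toCutCoord q) =
      2 * hypermetricBell bA bB q := by
  have hA := sum_linear_coeff bA fun i => q.atA (Sum.inl i)
  have hB := sum_linear_coeff bB fun j => q.atB (Sum.inl j)
  have hA' := sum_mul_sub_abs (fun p : IndexPair s => bA p.1.1 * bA p.1.2)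
    fun p => q.atB (Sum.inr p)
  have hB' := sum_mul_sub_abs (fun p : IndexPair t => bB p.1.1 * bB p.1.2)
    fun p => q.atA (Sum.inr p)
  push_cast at hA' hB'
  have e1 : ∀ a, (toCutCoord q).atA a = q.atA a := fun _ => rfl
  have e2 : ∀ b, (toCutCoord q).atB b = q.atB b := fun _ => rfl
  have e3 : ∀ a b, (toCutCoord q).atAB a b = q.atA a + q.atB b - 2 * q.atAB a b := fun _ _ => rfl
  have hAB : ∑ i, ∑ j, (bA i * bB j * (q.atA (Sum.inl i) + q.atB (Sum.inl j)
      - 2 * q.atAB (Sum.inl i) (Sum.inl j)) : ℝ) =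
      ∑ i, (∑ j, (bB j : ℝ)) * bA i * q.atA (Sum.inl i) +
      ∑ j, (∑ i, (bA i : ℝ)) * bB j * q.atB (Sum.inl j) -
      2 * ∑ i, ∑ j, (bA i : ℝ) * bB j * q.atAB (Sum.inl i) (Sum.inl j) := by
    have h1 : ∑ j, (∑ i, (bA i : ℝ)) * bB j * q.atB (Sum.inl j) =
        ∑ i, ∑ j, (bA i : ℝ) * bB j * q.atB (Sum.inl j) := by
      rw [Finset.sum_comm]
      simp only [Finset.sum_mul]
    have h2 : ∑ i, (∑ j, (bB j : ℝ)) * bA i * q.atA (Sum.inl i) =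
        ∑ i, ∑ j, (bA i : ℝ) * bB j * q.atA (Sum.inl i) := by
      simp only [Finset.sum_mul, mul_comm (bA _ : ℝ)]
    rw [h1, h2]
    simp only [Finset.mul_sum, ← Finset.sum_add_distrib, ← Finset.sum_sub_distrib]
    refine Finset.sum_congr rfl fun i _ => Finset.sum_congr rfl fun j _ => ?_
    ring
  simp only [triangularElimination, hypermetricCoeff, hypermetricWeight, e1, e2, e3,
    hypermetricBell, hAB]
  push_cast
  simp only [mul_add, mul_sub, sub_mul, Finset.sum_add_distrib, Finset.sum_sub_distrib,
    one_mul, mul_left_comm _ (2 : ℝ), ← Finset.mul_sum] at hA hB hA' hB' ⊢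
  linarith

/-! ### The triangular elimination evaluated on cuts -/

/-- The nodes of the tripartite graph after triangular elimination: the old nodes, and a new
node for each pair of old observables of Bob or of Alice. -/
def elimNodeEquiv (s t : ℕ) :
    CompleteNode s t ⊕ (IndexPair t ⊕ IndexPair s) ≃ Option (ElimA s t ⊕ ElimB s t) where
  toFun
    | Sum.inl none => none
    | Sum.inl (some (Sum.inl i)) => some (Sum.inl (Sum.inl i))
    | Sum.inl (some (Sum.inr j)) => some (Sum.inr (Sum.inl j))
    | Sum.inr (Sum.inl p) => some (Sum.inl (Sum.inr p))
    | Sum.inr (Sum.inr p) => some (Sum.inr (Sum.inr p))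
  invFun
    | none => Sum.inl none
    | some (Sum.inl (Sum.inl i)) => Sum.inl (some (Sum.inl i))
    | some (Sum.inr (Sum.inl j)) => Sum.inl (some (Sum.inr j))
    | some (Sum.inl (Sum.inr p)) => Sum.inr (Sum.inl p)
    | some (Sum.inr (Sum.inr p)) => Sum.inr (Sum.inr p)
  left_inv := by rintro ((_ | i | j) | p | p) <;> rfl
  right_inv := by rintro (_ | (i | p) | j | p) <;> rfl

/-- The first node of the pair to which a new node belongs. -/
def elimFst {s t : ℕ} : IndexPair t ⊕ IndexPair s → CompleteNode s t
  | Sum.inl p => CompleteNode.B p.1.1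
  | Sum.inr p => CompleteNode.A p.1.1

/-- The second node of the pair to which a new node belongs. -/
def elimSnd {s t : ℕ} : IndexPair t ⊕ IndexPair s → CompleteNode s t
  | Sum.inl p => CompleteNode.B p.1.2
  | Sum.inr p => CompleteNode.A p.1.2

/-- The cut vector of the old nodes in `S` and the new nodes in `T`. -/
def elimCutVec {s t : ℕ} (S : Finset (CompleteNode s t)) (T : Finset (IndexPair t ⊕ IndexPair s)) :
    BellVec (ElimA s t) (ElimB s t) :=
  cutVec ((S.disjSum T).map (elimNodeEquiv s t).toEmbedding)

/-- The indicator of two propositions having different truth values. -/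
noncomputable def separation (P Q : Prop) : ℝ :=
  open Classical in if P ↔ Q then 0 else 1

theorem separation_eq_ite (P Q : Prop) [Decidable P] [Decidable Q] :
    separation P Q = if P ↔ Q then 0 else 1 := by
  unfold separation
  congr

section

variable {s t : ℕ} (S : Finset (CompleteNode s t)) (T : Finset (IndexPair t ⊕ IndexPair s))

theorem elimCutVec_atA_inl (i : Fin s) : (elimCutVec S T).atA (Sum.inl i) =
    separation (CompleteNode.X ∈ S) (CompleteNode.A i ∈ S) := by
  simp [elimCutVec, BellVec.atA, cutVec, separation_eq_ite, elimNodeEquiv]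

theorem elimCutVec_atB_inl (j : Fin t) : (elimCutVec S T).atB (Sum.inl j) =
    separation (CompleteNode.X ∈ S) (CompleteNode.B j ∈ S) := by
  simp [elimCutVec, BellVec.atB, cutVec, separation_eq_ite, elimNodeEquiv]

theorem elimCutVec_atAB_inl_inl (i : Fin s) (j : Fin t) :
    (elimCutVec S T).atAB (Sum.inl i) (Sum.inl j) =
      separation (CompleteNode.A i ∈ S) (CompleteNode.B j ∈ S) := by
  simp [elimCutVec, BellVec.atAB, cutVec, separation_eq_ite, elimNodeEquiv]

theorem elimCutVec_atAB_inl_inr (i : Fin s) (p : IndexPair s) :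
    (elimCutVec S T).atAB (Sum.inl i) (Sum.inr p) =
      separation (CompleteNode.A i ∈ S) (Sum.inr p ∈ T) := by
  simp [elimCutVec, BellVec.atAB, cutVec, separation_eq_ite, elimNodeEquiv]

theorem elimCutVec_atAB_inr_inl (p : IndexPair t) (j : Fin t) :
    (elimCutVec S T).atAB (Sum.inr p) (Sum.inl j) =
      separation (CompleteNode.B j ∈ S) (Sum.inl p ∈ T) := by
  simp [elimCutVec, BellVec.atAB, cutVec, separation_eq_ite, elimNodeEquiv, iff_comm]

/-- The amount by which the new node `w` lowers the left hand side of the triangular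
elimination below that of the original inequality. -/
noncomputable def elimDefect (a : CompleteNode s t → CompleteNode s t → ℝ)
    (w : IndexPair t ⊕ IndexPair s) : ℝ :=
  a (elimFst w) (elimSnd w) * separation (elimFst w ∈ S) (w ∈ T)
    - |a (elimFst w) (elimSnd w)| * separation (elimSnd w ∈ S) (w ∈ T)
    - a (elimFst w) (elimSnd w) * separation (elimFst w ∈ S) (elimSnd w ∈ S)

/-- This is `|a|` times a triangle inequality on `elimFst w`, `elimSnd w`, `w`; the sign of the
coefficient `a` decides which one. -/
theorem elimDefect_nonpos (a : CompleteNode s t → CompleteNode s t → ℝ)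
    (w : IndexPair t ⊕ IndexPair s) : elimDefect S T a w ≤ 0 := by
  have h1 := le_abs_self (a (elimFst w) (elimSnd w))
  have h2 := neg_abs_le (a (elimFst w) (elimSnd w))
  simp only [elimDefect, separation_eq_ite]
  by_cases h3 : elimFst w ∈ S <;> by_cases h4 : elimSnd w ∈ S <;> by_cases h5 : w ∈ T <;>
    simp [h3, h4, h5] <;> linarith

/-- The triangle inequality is an equality if `w` is on the side of `elimSnd w`. On a slack cut it
is an equality wherever `w` lies. -/
theorem elimDefect_eq_zero {b : CompleteNode s t → ℤ} {w : IndexPair t ⊕ IndexPair s}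
    (h : IsSlack b (elimFst w) (elimSnd w) S ∨ (w ∈ T ↔ elimSnd w ∈ S)) :
    elimDefect S T (fun u v => (b u * b v : ℝ)) w = 0 := by
  simp only [elimDefect, separation_eq_ite]
  rcases h with h | h
  · rcases lt_trichotomy (b (elimFst w) * b (elimSnd w)) 0 with h' | h' | h'
    · have hr : (b (elimFst w) * b (elimSnd w) : ℝ) < 0 := by exact_mod_cast h'
      have := h.2 h'
      rw [abs_of_neg hr]
      by_cases h3 : elimFst w ∈ S <;> by_cases h4 : elimSnd w ∈ S <;> by_cases h5 : w ∈ T <;>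
        simp_all
    · have hr : (b (elimFst w) * b (elimSnd w) : ℝ) = 0 := by exact_mod_cast h'
      simp [hr]
    · have hr : 0 < (b (elimFst w) * b (elimSnd w) : ℝ) := by exact_mod_cast h'
      have := h.1 h'
      rw [abs_of_pos hr]
      simp [this]
  · simp [h]

theorem triangularElimination_elimCutVec {a : CompleteNode s t → CompleteNode s t → ℝ}
    (ha : ∀ u v, a u v = a v u) :
    triangularElimination a (elimCutVec S T) = cutWeight a S + ∑ w, elimDefect S T a w := by
  have h : ∀ (P Q : Prop) [Decidable P] [Decidable Q] (r : ℝ),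
      (if P ∧ ¬Q then r else 0) + (if Q ∧ ¬P then r else 0) = r * separation P Q := by
    intro P Q _ _ r
    by_cases hP : P <;> by_cases hQ : Q <;> simp [hP, hQ, separation_eq_ite]
  have hcut : cutWeight a S =
      (∑ i, a CompleteNode.X (CompleteNode.A i) *
        separation (CompleteNode.X ∈ S) (CompleteNode.A i ∈ S)) +
      (∑ j, a CompleteNode.X (CompleteNode.B j) *
        separation (CompleteNode.X ∈ S) (CompleteNode.B j ∈ S)) +
      (∑ i, ∑ j, a (CompleteNode.A i) (CompleteNode.B j) *
        separation (CompleteNode.A i ∈ S) (CompleteNode.B j ∈ S)) +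
      (∑ p : IndexPair s, a (CompleteNode.A p.1.1) (CompleteNode.A p.1.2) *
        separation (CompleteNode.A p.1.1 ∈ S) (CompleteNode.A p.1.2 ∈ S)) +
      ∑ p : IndexPair t, a (CompleteNode.B p.1.1) (CompleteNode.B p.1.2) *
        separation (CompleteNode.B p.1.1 ∈ S) (CompleteNode.B p.1.2 ∈ S) := by
    rw [cutWeight_eq_sum_ite]
    simp only [Fintype.sum_option, Fintype.sum_sum_type, Finset.sum_add_distrib]
    rw [sum_sum_eq_sum_indexPair (n := s), sum_sum_eq_sum_indexPair (n := t),
      Finset.sum_comm (s := (Finset.univ : Finset (Fin t))) (t := (Finset.univ : Finset (Fin s)))]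
    simp only [← h, Finset.sum_add_distrib, and_not_self_iff, if_false, Finset.sum_const_zero]
    simp only [ha (some (Sum.inl _)) none, ha (some (Sum.inr _)) none,
      ha (some (Sum.inr _)) (some (Sum.inl _))]
    simp only [fun p : IndexPair s => ha (some (Sum.inl p.1.2)) (some (Sum.inl p.1.1)),
      fun p : IndexPair t => ha (some (Sum.inr p.1.2)) (some (Sum.inr p.1.1))]
    ring
  rw [hcut, triangularElimination, Fintype.sum_sum_type]
  simp only [elimCutVec_atA_inl, elimCutVec_atB_inl, elimCutVec_atAB_inl_inl,
    elimCutVec_atAB_inl_inr, elimCutVec_atAB_inr_inl, elimDefect, elimFst, elimSnd,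
    Finset.sum_sub_distrib]
  ring

end

theorem sum_hypermetricWeight {s t : ℕ} (bA : Fin s → ℤ) (bB : Fin t → ℤ) :
    ∑ v, hypermetricWeight bA bB v = 1 := by
  simp only [Fintype.sum_option, Fintype.sum_sum_type, hypermetricWeight]
  ring

theorem triangularElimination_hypermetricCoeff_elimCutVec {s t : ℕ} (bA : Fin s → ℤ)
    (bB : Fin t → ℤ) (S : Finset (CompleteNode s t)) (T : Finset (IndexPair t ⊕ IndexPair s)) :
    triangularElimination (hypermetricCoeff bA bB) (elimCutVec S T) =
      (((∑ v ∈ S, hypermetricWeight bA bB v) * (1 - ∑ v ∈ S, hypermetricWeight bA bB v) : ℤ) : ℝ)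
        + ∑ w, elimDefect S T (hypermetricCoeff bA bB) w := by
  rw [triangularElimination_elimCutVec S T (a := hypermetricCoeff bA bB) fun u v => mul_comm _ _,
    ← cutWeight_mul (sum_hypermetricWeight bA bB)]
  rfl

/-! ### Classical results as cut vectors, and validity -/

/-- `toCutCoord` as a linear equivalence. -/
noncomputable def toCutCoordEquiv (α β : Type) : BellVec α β ≃ₗ[ℝ] BellVec α β where
  toFun := toCutCoord
  map_add' p q := by
    funext c
    rcases c with a | b | ⟨a, b⟩ <;> simp [toCutCoord, BellVec.atA, BellVec.atB, BellVec.atAB]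
    ring
  map_smul' r q := by
    funext c
    rcases c with a | b | ⟨a, b⟩ <;> simp [toCutCoord, BellVec.atA, BellVec.atB, BellVec.atAB]
    ring
  invFun x
    | Sum.inl a => x.atA a
    | Sum.inr (Sum.inl b) => x.atB b
    | Sum.inr (Sum.inr (a, b)) => (x.atA a + x.atB b - x.atAB a b) / 2
  left_inv q := by
    funext c
    rcases c with a | b | ⟨a, b⟩ <;> simp [toCutCoord, BellVec.atA, BellVec.atB, BellVec.atAB]
  right_inv q := by
    funext c
    rcases c with a | b | ⟨a, b⟩ <;> simp [toCutCoord, BellVec.atA, BellVec.atB, BellVec.atAB]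
    ring

theorem exists_classicalResult_eq_cutVec {α β : Type} [DecidableEq α] [DecidableEq β]
    (S : Finset (Option (α ⊕ β))) :
    ∃ f g, toCutCoord (classicalResult f g) = (cutVec S : BellVec α β) := by
  -- Outcome `1` means being separated from `X`.
  refine ⟨fun a => decide ¬(none ∈ S ↔ some (Sum.inl a) ∈ S),
    fun b => decide ¬(none ∈ S ↔ some (Sum.inr b) ∈ S), ?_⟩
  funext c
  rcases c with a | b | ⟨a, b⟩
  · simp [toCutCoord, BellVec.atA, classicalResult, cutVec]
  · simp [toCutCoord, BellVec.atB, classicalResult, cutVec]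
  · by_cases h1 : none ∈ S <;> by_cases h2 : some (Sum.inl a) ∈ S <;>
      by_cases h3 : some (Sum.inr b) ∈ S <;>
      simp [toCutCoord, BellVec.atA, BellVec.atB, BellVec.atAB, classicalResult, cutVec, h1, h2,
        h3] <;> norm_num

theorem exists_cutVec_eq_classicalResult {α β : Type} [Fintype α] [Fintype β] [DecidableEq α]
    [DecidableEq β] (f : α → Bool) (g : β → Bool) :
    ∃ S, (cutVec S : BellVec α β) = toCutCoord (classicalResult f g) := by
  refine ⟨Finset.univ.filter fun u => u.elim false (Sum.elim f g) = true, ?_⟩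
  funext c
  rcases c with a | b | ⟨a, b⟩
  · simp [toCutCoord, BellVec.atA, classicalResult, cutVec]
    cases f a <;> simp
  · simp [toCutCoord, BellVec.atB, classicalResult, cutVec]
    cases g b <;> simp
  · cases h1 : f a <;> cases h2 : g b <;>
      simp [toCutCoord, BellVec.atA, BellVec.atB, BellVec.atAB, classicalResult, cutVec, h1, h2]
    norm_num

theorem exists_elimCutVec_eq_classicalResult {s t : ℕ} (f : ElimA s t → Bool)
    (g : ElimB s t → Bool) : ∃ S T, elimCutVec S T = toCutCoord (classicalResult f g) := by
  obtain ⟨M, hM⟩ := exists_cutVec_eq_classicalResult f g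
  refine ⟨(M.map (elimNodeEquiv s t).symm.toEmbedding).toLeft,
    (M.map (elimNodeEquiv s t).symm.toEmbedding).toRight, ?_⟩
  rw [elimCutVec, Finset.toLeft_disjSum_toRight, Finset.map_map, ← hM]
  congr 1
  ext u
  simp

/-- The left hand side of a triangular elimination as a linear form. -/
noncomputable def triangularEliminationForm {s t : ℕ}
    (a : CompleteNode s t → CompleteNode s t → ℝ) : BellVec (ElimA s t) (ElimB s t) →ₗ[ℝ] ℝ where
  toFun := triangularElimination a
  map_add' x y := by
    simp only [triangularElimination, BellVec.atA, BellVec.atB, BellVec.atAB, Pi.add_apply, mul_add,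
      Finset.sum_add_distrib, Finset.sum_sub_distrib]
    ring
  map_smul' r x := by
    simp only [triangularElimination, BellVec.atA, BellVec.atB, BellVec.atAB, Pi.smul_apply,
      smul_eq_mul, RingHom.id_apply, mul_left_comm _ r, ← mul_sub, ← Finset.mul_sum, ← mul_add]

/-- The form `hypermetricBell` as a linear form. -/
noncomputable def hypermetricBellForm {s t : ℕ} (bA : Fin s → ℤ) (bB : Fin t → ℤ) :
    BellVec (ElimA s t) (ElimB s t) →ₗ[ℝ] ℝ :=
  (1 / 2 : ℝ) • triangularEliminationForm (hypermetricCoeff bA bB) ∘ₗ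
    (toCutCoordEquiv (ElimA s t) (ElimB s t)).toLinearMap

theorem hypermetricBellForm_apply {s t : ℕ} (bA : Fin s → ℤ) (bB : Fin t → ℤ)
    (q : BellVec (ElimA s t) (ElimB s t)) :
    hypermetricBellForm bA bB q = hypermetricBell bA bB q := by
  have h := triangularElimination_hypermetricCoeff bA bB q
  change (1 / 2 : ℝ) * triangularElimination (hypermetricCoeff bA bB) (toCutCoord q) = _
  rw [h]
  ring

theorem IsPureHypermetricWeight.isFacetWeight {s t : ℕ} {b : CompleteNode s t → ℤ}
    (h : IsPureHypermetricWeight b) (hsum : ∑ v, b v = 1) : IsFacetWeight b := by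
  obtain ⟨l, hl, h1, -, hall⟩ := h
  refine ⟨hsum, fun v => by rcases hall v with h | h | h <;> omega, ?_⟩
  have : (Finset.univ.filter fun v => b v = 1).card ≤ (Finset.univ.filter fun v => 0 < b v).card :=
    Finset.card_le_card (Finset.monotone_filter_right _ fun v _ (hv : b v = 1) => by omega)
  omega

theorem IsMinusOneHypermetricWeight.isFacetWeight {s t : ℕ} {b : CompleteNode s t → ℤ}
    (h : IsMinusOneHypermetricWeight b) (hsum : ∑ v, b v = 1) : IsFacetWeight b :=
  ⟨hsum, fun v => by rcases h.2.2 v with h | h <;> omega, h.1⟩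

theorem hypermetricBell_classicalResult {s t : ℕ} (bA : Fin s → ℤ) (bB : Fin t → ℤ)
    {f : ElimA s t → Bool} {g : ElimB s t → Bool} {S : Finset (CompleteNode s t)}
    {T : Finset (IndexPair t ⊕ IndexPair s)}
    (h : elimCutVec S T = toCutCoord (classicalResult f g)) :
    2 * hypermetricBell bA bB (classicalResult f g) =
      (((∑ v ∈ S, hypermetricWeight bA bB v) * (1 - ∑ v ∈ S, hypermetricWeight bA bB v) : ℤ) : ℝ)
        + ∑ w, elimDefect S T (hypermetricCoeff bA bB) w := by
  rw [← triangularElimination_hypermetricCoeff, ← h,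
    triangularElimination_hypermetricCoeff_elimCutVec]

theorem hypermetricBell_classicalResult_nonpos {s t : ℕ} (bA : Fin s → ℤ) (bB : Fin t → ℤ)
    (f : ElimA s t → Bool) (g : ElimB s t → Bool) :
    hypermetricBell bA bB (classicalResult f g) ≤ 0 := by
  obtain ⟨S, T, h⟩ := exists_elimCutVec_eq_classicalResult f g
  have h1 := hypermetricBell_classicalResult bA bB h
  have h2 : ∑ w, elimDefect S T (hypermetricCoeff bA bB) w ≤ 0 :=
    Finset.sum_nonpos fun w _ => elimDefect_nonpos S T _ w
  have h3 : ∀ n : ℤ, n * (1 - n) ≤ 0 := by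
    intro n
    rcases le_or_gt n 0 with h | h <;> nlinarith
  have h4 : (((∑ v ∈ S, hypermetricWeight bA bB v) *
      (1 - ∑ v ∈ S, hypermetricWeight bA bB v) : ℤ) : ℝ) ≤ 0 := by exact_mod_cast h3 _
  linarith

theorem isBellInequality_hypermetricBell {s t : ℕ} (bA : Fin s → ℤ) (bB : Fin t → ℤ) :
    IsBellInequality (hypermetricBell bA bB) 0 := by
  have hF : hypermetricBell bA bB = hypermetricBellForm bA bB :=
    funext fun q => (hypermetricBellForm_apply bA bB q).symm
  refine ⟨hF ▸ (hypermetricBellForm bA bB).isLinear, fun q hq => ?_⟩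
  have hconv : Convex ℝ {q | hypermetricBellForm bA bB q ≤ 0} :=
    convex_halfSpace_le (hypermetricBellForm bA bB).isLinear 0
  have := convexHull_min (Set.range_subset_iff.2 fun c => ?_) hconv hq
  · rwa [Set.mem_ofPred_eq, hypermetricBellForm_apply] at this
  · rw [Set.mem_ofPred_eq, hypermetricBellForm_apply]
    exact hypermetricBell_classicalResult_nonpos bA bB c.1 c.2

/-! ### Uniqueness of the form, and the facet -/

/-- A linear form on the cut space that vanishes on the cut vectors satisfying the triangular
elimination with equality is a multiple of it. -/
theorem exists_eq_mul_triangularElimination {s t : ℕ} {bA : Fin s → ℤ} {bB : Fin t → ℤ}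
    (hb : IsFacetWeight (hypermetricWeight bA bB)) (Γ : BellVec (ElimA s t) (ElimB s t) →ₗ[ℝ] ℝ)
    (hΓ : ∀ S T, triangularElimination (hypermetricCoeff bA bB) (elimCutVec S T) = 0 →
      Γ (elimCutVec S T) = 0) :
    ∃ r : ℝ, ∀ x, Γ x = r * triangularElimination (hypermetricCoeff bA bB) x := by
  set γ : BellVec (ElimA s t) (ElimB s t) := fun c => Γ (Pi.single c 1) with hγ
  have hsum : ∀ x, Γ x = ∑ c, γ c * x c := by
    intro x
    conv_lhs => rw [← Finset.univ_sum_single x]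
    rw [map_sum]
    refine Finset.sum_congr rfl fun c _ => ?_
    have : (Pi.single c (x c) : BellVec (ElimA s t) (ElimB s t)) = x c • Pi.single c 1 := by
      rw [← Pi.single_smul, smul_eq_mul, mul_one]
    rw [this, map_smul, smul_eq_mul, mul_comm]
  obtain ⟨hW, hrow, r, hold, hnew⟩ := hb.exists_eq_mul_of_elimination (e₁ := elimFst)
    (e₂ := elimSnd)
    (g := fun u v => tripartiteWeight γ (elimNodeEquiv s t u) (elimNodeEquiv s t v))
    (by
      rintro (⟨p, hp⟩ | ⟨p, hp⟩) <;> simp [elimFst, elimSnd, hp.ne])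
    (by
      rintro (⟨⟨p, p'⟩, hp⟩ | ⟨⟨p, p'⟩, hp⟩) (⟨⟨q, q'⟩, hq⟩ | ⟨⟨q, q'⟩, hq⟩) <;>
        simp +contextual [elimFst, elimSnd])
    (by
      rintro (⟨⟨p, p'⟩, hp⟩ | ⟨⟨p, p'⟩, hp⟩) (⟨⟨q, q'⟩, hq⟩ | ⟨⟨q, q'⟩, hq⟩) <;>
        simp only [elimFst, elimSnd, ne_eq, Option.some.injEq, Sum.inl.injEq, Sum.inr.injEq,
          reduceCtorEq, not_false_eq_true, implies_true] <;>
      · rintro rfl rfl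
        exact lt_asymm hp hq)
    (fun u v => tripartiteWeight_symm γ _ _) (fun u => tripartiteWeight_self γ _)
    (by rintro (p | p) <;> rfl)
    (by
      rintro (p | p) (q | q)
      · exact Or.inl rfl
      · exact Or.inr (by simp [elimFst, elimSnd])
      · exact Or.inr (by simp [elimFst, elimSnd])
      · exact Or.inl rfl)
    (fun S T hS hT => by
      rw [cutWeight_comp_equiv (elimNodeEquiv s t), cutWeight_tripartiteWeight]
      refine (hsum (elimCutVec S T)).symm.trans (hΓ S T ?_)
      have hd : ∑ w, elimDefect S T (hypermetricCoeff bA bB) w = 0 :=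
        Finset.sum_eq_zero fun w _ => elimDefect_eq_zero S T (hT w)
      rw [triangularElimination_hypermetricCoeff_elimCutVec, hd]
      rcases hS with h | h <;> rw [h] <;> simp)
  have hXA : ∀ i, γ (Sum.inl (Sum.inl i)) =
      r * hypermetricCoeff bA bB CompleteNode.X (CompleteNode.A i) := fun i =>
    hold none (some (Sum.inl i)) (by simp) (by rintro (p | p) <;> simp [elimFst, elimSnd])
  have hXB : ∀ j, γ (Sum.inr (Sum.inl (Sum.inl j))) =
      r * hypermetricCoeff bA bB CompleteNode.X (CompleteNode.B j) := fun j =>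
    hold none (some (Sum.inr j)) (by simp) (by rintro (p | p) <;> simp [elimFst, elimSnd])
  have hAB : ∀ i j, γ (Sum.inr (Sum.inr (Sum.inl i, Sum.inl j))) =
      r * hypermetricCoeff bA bB (CompleteNode.A i) (CompleteNode.B j) := fun i j =>
    hold (some (Sum.inl i)) (some (Sum.inr j)) (by simp)
      (by rintro (p | p) <;> simp [elimFst, elimSnd])
  have hXA' : ∀ p, γ (Sum.inl (Sum.inr p)) = 0 := fun p =>
    hrow (Sum.inl p) none (by simp [elimFst]) (by simp [elimSnd])
  have hXB' : ∀ p, γ (Sum.inr (Sum.inl (Sum.inr p))) = 0 := fun p =>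
    hrow (Sum.inr p) none (by simp [elimFst]) (by simp [elimSnd])
  have hA'B' : ∀ p p', γ (Sum.inr (Sum.inr (Sum.inr p, Sum.inr p'))) = 0 := fun p p' =>
    hW (Sum.inl p) (Sum.inr p')
  have hAB' : ∀ p : IndexPair s, ∀ x : Fin s → ℝ,
      ∑ i, γ (Sum.inr (Sum.inr (Sum.inl i, Sum.inr p))) * x i =
        r * (hypermetricCoeff bA bB (CompleteNode.A p.1.1) (CompleteNode.A p.1.2) * x p.1.1 -
          |hypermetricCoeff bA bB (CompleteNode.A p.1.1) (CompleteNode.A p.1.2)| * x p.1.2) := by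
    intro p x
    have h1 : γ (Sum.inr (Sum.inr (Sum.inl p.1.1, Sum.inr p))) = r * hypermetricCoeff bA bB
      (CompleteNode.A p.1.1) (CompleteNode.A p.1.2) := (hnew (Sum.inr p)).1
    have h2 : γ (Sum.inr (Sum.inr (Sum.inl p.1.2, Sum.inr p))) = -(r * |hypermetricCoeff bA bB
      (CompleteNode.A p.1.1) (CompleteNode.A p.1.2)|) := (hnew (Sum.inr p)).2
    rw [Fintype.sum_eq_add p.1.1 p.1.2 p.2.ne, h1, h2]
    · ring
    · intro i hi
      have h3 : γ (Sum.inr (Sum.inr (Sum.inl i, Sum.inr p))) = 0 := hrow (Sum.inr p)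
        (CompleteNode.A i) (by simp [elimFst, hi.1]) (by simp [elimSnd, hi.2])
      rw [h3, zero_mul]
  have hA'B : ∀ p : IndexPair t, ∀ x : Fin t → ℝ,
      ∑ j, γ (Sum.inr (Sum.inr (Sum.inr p, Sum.inl j))) * x j =
        r * (hypermetricCoeff bA bB (CompleteNode.B p.1.1) (CompleteNode.B p.1.2) * x p.1.1 -
          |hypermetricCoeff bA bB (CompleteNode.B p.1.1) (CompleteNode.B p.1.2)| * x p.1.2) := by
    intro p x
    have h1 : γ (Sum.inr (Sum.inr (Sum.inr p, Sum.inl p.1.1))) = r * hypermetricCoeff bA bB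
      (CompleteNode.B p.1.1) (CompleteNode.B p.1.2) := (hnew (Sum.inl p)).1
    have h2 : γ (Sum.inr (Sum.inr (Sum.inr p, Sum.inl p.1.2))) = -(r * |hypermetricCoeff bA bB
      (CompleteNode.B p.1.1) (CompleteNode.B p.1.2)|) := (hnew (Sum.inl p)).2
    rw [Fintype.sum_eq_add p.1.1 p.1.2 p.2.ne, h1, h2]
    · ring
    · intro j hj
      have h3 : γ (Sum.inr (Sum.inr (Sum.inr p, Sum.inl j))) = 0 := hrow (Sum.inl p)
        (CompleteNode.B j) (by simp [elimFst, hj.1]) (by simp [elimSnd, hj.2])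
      rw [h3, zero_mul]
  refine ⟨r, fun x => ?_⟩
  rw [hsum]
  simp only [Fintype.sum_sum_type, Fintype.sum_prod_type, Finset.sum_add_distrib]
  rw [Finset.sum_comm (s := (Finset.univ : Finset (Fin s)))
    (t := (Finset.univ : Finset (IndexPair s)))]
  simp only [hAB', hA'B, hXA, hXB, hAB, hXA', hXB', hA'B', zero_mul, Finset.sum_const_zero,
    add_zero, triangularElimination, mul_assoc, ← Finset.mul_sum, ← mul_add]
  simp only [BellVec.atA, BellVec.atB, BellVec.atAB]
  ring

/-- A linear form that vanishes on the classical results for which `hypermetricBell` is zero is a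
multiple of it. -/
theorem exists_eq_mul_hypermetricBell {s t : ℕ} {bA : Fin s → ℤ} {bB : Fin t → ℤ}
    (hb : IsFacetWeight (hypermetricWeight bA bB)) (G : BellVec (ElimA s t) (ElimB s t) →ₗ[ℝ] ℝ)
    (hG : ∀ f g, hypermetricBell bA bB (classicalResult f g) = 0 → G (classicalResult f g) = 0) :
    ∃ r : ℝ, ∀ q, G q = r * hypermetricBell bA bB q := by
  have hinv : ∀ q, (toCutCoordEquiv (ElimA s t) (ElimB s t)).symm (toCutCoord q) = q :=
    (toCutCoordEquiv (ElimA s t) (ElimB s t)).symm_apply_apply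
  obtain ⟨r, hr⟩ := exists_eq_mul_triangularElimination hb
    (G ∘ₗ (toCutCoordEquiv (ElimA s t) (ElimB s t)).symm.toLinearMap) (fun S T h => by
      obtain ⟨f, g, hfg⟩ := exists_classicalResult_eq_cutVec
        ((S.disjSum T).map (elimNodeEquiv s t).toEmbedding)
      change _ = elimCutVec S T at hfg
      rw [← hfg, triangularElimination_hypermetricCoeff] at h
      rw [← hfg]
      change G ((toCutCoordEquiv (ElimA s t) (ElimB s t)).symm (toCutCoord _)) = 0
      rw [hinv]
      exact hG f g (by linarith))
  refine ⟨2 * r, fun q => ?_⟩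
  have h : G ((toCutCoordEquiv (ElimA s t) (ElimB s t)).symm (toCutCoord q)) = _ := hr (toCutCoord q)
  rw [hinv, triangularElimination_hypermetricCoeff] at h
  linarith

/-- Two positive nodes have total weight `σ ≥ 2`, so `σ (1 - σ) < 0`, and the defects only lower the
value. -/
theorem exists_hypermetricBell_neg {s t : ℕ} {bA : Fin s → ℤ} {bB : Fin t → ℤ}
    (hb : IsFacetWeight (hypermetricWeight bA bB)) :
    ∃ f g, hypermetricBell bA bB (classicalResult f g) < 0 := by
  obtain ⟨j, hj, -, -⟩ := hb.exists_pos_ne none none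
  obtain ⟨k, hk, hkj, -⟩ := hb.exists_pos_ne j j
  obtain ⟨f, g, hfg⟩ := exists_classicalResult_eq_cutVec
    ((Finset.disjSum {j, k} ∅).map (elimNodeEquiv s t).toEmbedding)
  refine ⟨f, g, ?_⟩
  have h1 := hypermetricBell_classicalResult bA bB (S := {j, k}) (T := ∅) hfg.symm
  have h2 : ∑ w, elimDefect {j, k} ∅ (hypermetricCoeff bA bB) w ≤ 0 :=
    Finset.sum_nonpos fun w _ => elimDefect_nonpos _ _ _ w
  rw [Finset.sum_pair hkj.symm] at h1
  have h3 : (((hypermetricWeight bA bB j + hypermetricWeight bA bB k) *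
      (1 - (hypermetricWeight bA bB j + hypermetricWeight bA bB k)) : ℤ) : ℝ) < 0 := by
    have : (hypermetricWeight bA bB j + hypermetricWeight bA bB k) *
      (1 - (hypermetricWeight bA bB j + hypermetricWeight bA bB k)) < 0 := by nlinarith
    exact_mod_cast this
  linarith

theorem zero_mem_bellFace {s t : ℕ} (bA : Fin s → ℤ) (bB : Fin t → ℤ) :
    (0 : BellVec (ElimA s t) (ElimB s t)) ∈ bellFace (hypermetricBell bA bB) 0 := by
  refine ⟨subset_convexHull ℝ _ ⟨(fun _ => false, fun _ => false), ?_⟩, ?_⟩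
  · funext c
    rcases c with a | b | ⟨a, b⟩ <;> simp [classicalResult]
  · rw [← hypermetricBellForm_apply, map_zero]

theorem vectorSpan_eq_span_of_zero_mem {E : Type*} [AddCommGroup E] [Module ℝ E] {A : Set E}
    (h : (0 : E) ∈ A) : vectorSpan ℝ A = Submodule.span ℝ A := by
  rw [vectorSpan_eq_span_vsub_set_right ℝ h]
  simp

/-- The hypermetric Bell inequality of `b` is tight. -/
theorem isTightBellInequality_hypermetricBell {s t : ℕ} {bA : Fin s → ℤ} {bB : Fin t → ℤ}
    (hb : IsFacetWeight (hypermetricWeight bA bB)) :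
    IsTightBellInequality (hypermetricBell bA bB) 0 := by
  have h0 := zero_mem_bellFace bA bB
  refine ⟨isBellInequality_hypermetricBell bA bB, ⟨0, h0⟩, ?_⟩
  obtain ⟨f₀, g₀, hneg⟩ := exists_hypermetricBell_neg hb
  have hmem : ∀ f g, classicalResult f g ∈ correlationPolytope (ElimA s t) (ElimB s t) :=
    fun f g => subset_convexHull ℝ _ ⟨(f, g), rfl⟩
  rw [vectorSpan_eq_span_of_zero_mem h0, vectorSpan_eq_span_of_zero_mem h0.1]
  have hface : Submodule.span ℝ (bellFace (hypermetricBell bA bB) 0) =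
      LinearMap.ker (hypermetricBellForm bA bB) := by
    refine le_antisymm (Submodule.span_le.2 fun q hq => ?_) fun q hq => ?_
    · rw [SetLike.mem_coe, LinearMap.mem_ker, hypermetricBellForm_apply]
      exact hq.2
    -- A point of the kernel outside the span would be detected by a form that vanishes on the face.
    -- Such a form is a multiple of `hypermetricBell` and hence vanishes at the point.
    · by_contra hn
      obtain ⟨G, hGq, hG⟩ := Submodule.exists_le_ker_of_notMem hn
      obtain ⟨r, hr⟩ := exists_eq_mul_hypermetricBell hb G fun f g hfg =>
        hG (Submodule.subset_span ⟨hmem f g, hfg⟩)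
      rw [LinearMap.mem_ker, hypermetricBellForm_apply] at hq
      exact hGq (by rw [hr, hq, mul_zero])
  have hpoly : Submodule.span ℝ (correlationPolytope (ElimA s t) (ElimB s t)) = ⊤ := by
    refine eq_top_iff.2 fun q _ => ?_
    by_contra hn
    obtain ⟨G, hGq, hG⟩ := Submodule.exists_le_ker_of_notMem hn
    have hG' : ∀ f g, G (classicalResult f g) = 0 := fun f g =>
      hG (Submodule.subset_span (hmem f g))
    obtain ⟨r, hr⟩ := exists_eq_mul_hypermetricBell hb G fun f g _ => hG' f g
    have hr0 : r = 0 := by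
      have h := hG' f₀ g₀
      rw [hr] at h
      exact (mul_eq_zero.1 h).resolve_right hneg.ne
    exact hGq (by rw [hr, hr0, zero_mul])
  rw [hface, hpoly, finrank_top]
  refine Module.Dual.finrank_ker_add_one_of_ne_zero fun h => hneg.ne ?_
  rw [← hypermetricBellForm_apply, h, LinearMap.zero_apply]

theorem theorem3p1 (s t : ℕ) (bA : Fin s → ℤ) (bB : Fin t → ℤ) :
    (∀ q : BellVec (ElimA s t) (ElimB s t),
      triangularElimination (hypermetricCoeff bA bB) (toCutCoord q) =
        2 * hypermetricBell bA bB q) ∧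
    (IsPureHypermetricWeight (hypermetricWeight bA bB) ∨
        IsMinusOneHypermetricWeight (hypermetricWeight bA bB) →
      IsTightBellInequality (hypermetricBell bA bB) 0) := by
  refine ⟨triangularElimination_hypermetricCoeff bA bB, fun h => ?_⟩
  have hsum := sum_hypermetricWeight bA bB
  exact isTightBellInequality_hypermetricBell
    (h.elim (fun h => h.isFacetWeight hsum) fun h => h.isFacetWeight hsum)
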